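/- Let $p\ge 5$ be a prime, let $k\ge 2$, and let $\chi$ be an even Dirichlet character of conductor $q=p^k$ (a primitive character modulo $q$). Write $e_n(x)=\exp(2\pi i x/n)$. Let $\ell_\chi\in\mathbb Z/p^{k-1}\mathbb Z$ be the parameter defined by $$\chi(1+px)=e_{p^k}\big(\ell_\chi\log(1+px)\big)\qquad\text{for all } x\in\mathbb Z,$$ where $\log$ is the $p$-adic logarithm, $\log(1+y)=\sum_{n\ge1}(-1)^{n+1}y^n/n$ (there is exactly one such residue class $\ell_\chi$). Let $j$ be an integer with $k/3\le j\le k/2$, and let $m$ be an integer with $\gcd(m,p)=1$. Let $H^+_{p^j}$ be the group of even Dirichlet characters modulo $p^j$, viewed as characters modulo $p^k$, and for a primitive character $\eta$ let $\epsilon(\eta)$ be the root number of $L(s,\eta)$ (so $\epsilon(\eta)=q^{-1/2}\sum_{t \bmod q}\eta(t)e_q(t)$ for $\eta\in\chi H^+_{p^j}$). Let $\epsilon_q=1$ if $q\equiv1\pmod 4$ and $\epsilon_q=i$ if $q\equiv3\pmod4$. Then $$\sum_{\eta\in\chi H^+_{p^j}}\epsilon(\eta)\,\overline{\eta}(m)=\varphi(p^j)\sum_{\pm}\tfrac12\,e_{p^k}(\pm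 m)\,\delta\big(\ell_\chi\equiv\mp m \!\!\pmod{p^j}\big)\Big(\frac{-2\ell_\chi}{q}\Big)\,\epsilon_q\; e_{p^{k-2j}}\!\Big(\overline{2\ell_\chi}\,\Big(\frac{\ell_\chi\pm m}{p^j}\Big)^2\Big).$$ Here $\delta(P)$ is $1$ if $P$ holds and $0$ otherwise, $\big(\frac{\cdot}{q}\big)$ is the Jacobi symbol, $\overline{2\ell_\chi}$ is the inverse of $2\ell_\chi$ modulo $p^{k-2j}$, and on the right side $\ell_\chi$ may be replaced by any integer representing it. -/

import Mathlib

/-- The `p`-adic logarithm of `1 + y`, by its power series `∑ (-1)^n y^(n+1) / (n+1)`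
(which converges for `‖y‖ < 1`). -/
noncomputable def padicLogOneAdd (p : ℕ) [Fact p.Prime] (y : ℚ_[p]) : ℚ_[p] :=
  ∑' n : ℕ, (-1) ^ n * y ^ (n + 1) / ((n : ℚ_[p]) + 1)

/-- The series for `log (1 + p x)` converges to a `p`-adic integer. -/
theorem norm_padicLogOneAdd_le_one (p : ℕ) [Fact p.Prime] (x : ℤ) :
    ‖padicLogOneAdd p ((p : ℚ_[p]) * (x : ℚ_[p]))‖ ≤ 1 := by
  have hp : p.Prime := Fact.out
  refine (IsUltrametricDist.norm_tsum_le _).trans (ciSup_le fun n => ?_)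
  have hx : ‖(x : ℚ_[p])‖ ≤ 1 := Padic.norm_int_le_one x
  have hn : ((n : ℚ_[p]) + 1) ≠ 0 := by exact_mod_cast Nat.succ_ne_zero n
  have hv : padicValNat p (n + 1) ≤ n + 1 := by
    have h1 : p ^ padicValNat p (n + 1) ≤ n + 1 :=
      Nat.le_of_dvd (Nat.succ_pos n) pow_padicValNat_dvd
    have h2 : n + 1 < p ^ (n + 1) := Nat.lt_pow_self hp.one_lt
    exact ((Nat.pow_lt_pow_iff_right hp.one_lt).1 (h1.trans_lt h2)).le
  have hden : ‖((n : ℚ_[p]) + 1)‖ = ((p : ℝ) ^ padicValNat p (n + 1))⁻¹ := by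
    have h := Padic.norm_eq_zpow_neg_valuation hn
    have hc : ((n : ℚ_[p]) + 1) = ((n + 1 : ℕ) : ℚ_[p]) := by push_cast; rfl
    rw [hc] at h ⊢
    rw [h, Padic.valuation_natCast, zpow_neg, zpow_natCast]
  have hp1 : (1 : ℝ) ≤ p := by exact_mod_cast hp.one_lt.le
  rw [norm_div, norm_mul, norm_pow, norm_neg, norm_one, one_pow, one_mul, norm_pow, norm_mul,
    Padic.norm_p, mul_pow, hden, div_inv_eq_mul, inv_pow]
  have hpos : (0 : ℝ) < (p : ℝ) ^ (n + 1) := by positivity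
  have hA : (p : ℝ) ^ padicValNat p (n + 1) ≤ (p : ℝ) ^ (n + 1) := pow_le_pow_right₀ hp1 hv
  have hB : ‖(x : ℚ_[p])‖ ^ (n + 1) ≤ 1 := pow_le_one₀ (norm_nonneg _) hx
  calc ((p : ℝ) ^ (n + 1))⁻¹ * ‖(x : ℚ_[p])‖ ^ (n + 1) * (p : ℝ) ^ padicValNat p (n + 1)
      ≤ ((p : ℝ) ^ (n + 1))⁻¹ * 1 * (p : ℝ) ^ (n + 1) := by gcongr
    _ = 1 := by field_simp

/-- `log (1 + p x)` as a `p`-adic integer, for an integer `x`. -/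
noncomputable def padicIntLog (p : ℕ) [Fact p.Prime] (x : ℤ) : ℤ_[p] :=
  ⟨padicLogOneAdd p ((p : ℚ_[p]) * (x : ℚ_[p])), norm_padicLogOneAdd_le_one p x⟩

/-- `ℓ` is the logarithmic parameter of the character `χ` modulo `p ^ k`:
`χ (1 + p x) = e_{p^k} (ℓ log (1 + p x))` for every integer `x`.
Here `ZMod.stdAddChar` on `ZMod q` is `a ↦ e_q a = exp (2 π i a / q)`. As `log (1 + p x)` is divisible
by `p`, the right side depends only on `ℓ` modulo `p ^ (k - 1)`; the representative of `ℓ` in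
`[0, p ^ (k - 1))` is used. -/
def IsLogParam {p k : ℕ} [Fact p.Prime] (χ : DirichletCharacter ℂ (p ^ k))
    (ℓ : ZMod (p ^ (k - 1))) : Prop :=
  ∀ x : ℤ, χ (((1 + (p : ℤ) * x : ℤ)) : ZMod (p ^ k)) =
    ZMod.stdAddChar ((ℓ.val : ZMod (p ^ k)) * PadicInt.toZModPow k (padicIntLog p x))

open scoped Classical in
/-- The set `χ H⁺` of all `χ ψ`, where `ψ` runs over the even Dirichlet characters modulo `p ^ j`,
viewed as characters modulo `p ^ k`. -/
noncomputable def evenCoset {p k j : ℕ} [Fact p.Prime] (hjk : j ≤ k)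
    (χ : DirichletCharacter ℂ (p ^ k)) : Finset (DirichletCharacter ℂ (p ^ k)) :=
  Finset.univ.image fun ψ : {ψ : DirichletCharacter ℂ (p ^ j) // ψ.Even} =>
    χ * DirichletCharacter.changeLevel (pow_dvd_pow p hjk) ψ.1

/-- `ε_q` for odd `q`: it is `1` if `q ≡ 1 (mod 4)` and `i` if `q ≡ 3 (mod 4)`. -/
noncomputable def gaussSign (q : ℕ) : ℂ := if q % 4 = 1 then 1 else Complex.I

/-! Orthogonality over the even characters modulo `p ^ j` restricts the Gauss sums defining the root
numbers to `t ≡ ±m` modulo `p ^ j`. Writing `t = s * m * (1 + p ^ j * u)` with `s = ±1`, evenness of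
`χ` leaves only `χ (1 + p ^ j * u)` times an additive character (`sum_evenCoset`).

Since `k ≤ 3 * j`, the logarithm may be truncated after its quadratic term, so this value is
`e_{p^k}` of a quadratic polynomial in `p ^ j * u` (`IsLogParam.apply_one_add`). Since `2 * j ≤ k`,
one splits `u = v + p ^ (k - 2 * j) * w`. The sum over `w` is linear and forces `ℓ ≡ -s * m` modulo
`p ^ j`; the sum over `v` becomes, after completing the square, a quadratic Gauss sum modulo `p ^ (k
- 2 * j)`. Its value gives the Jacobi symbol, `ε_q` and a square root that cancels against `q ^
(1/2)`.

Two classical inputs are proved on the way. The logarithm is additive and isometric on `1 + p ℤ_p`,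
which yields the existence and uniqueness of `ℓ`. The sign of the quadratic Gauss sum comes from
Gauss's own argument with q-binomial coefficients, followed by reduction of prime powers two
exponents at a time. -/

/-! ### The `p`-adic logarithm: convergence, additivity, isometry -/

section PadicLog

open Filter Topology

/-- The `n`-th term of the logarithm series is at most `‖y‖ ^ 3`, from the cubic term on. -/
theorem padicLog_term_norm_le {p : ℕ} [Fact p.Prime] (hp : 5 ≤ p) {y : ℚ_[p]}
    (hy : ‖y‖ ≤ (p : ℝ)⁻¹) (n : ℕ) :
    ‖y ^ (n + 3) / (((n + 2 : ℕ) : ℚ_[p]) + 1)‖ ≤ ‖y‖ ^ 3 * 2⁻¹ ^ n := by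
  have hpp : p.Prime := Fact.out
  have hn : (((n + 2 : ℕ) : ℚ_[p]) + 1) ≠ 0 := by exact_mod_cast Nat.succ_ne_zero (n + 2)
  have hp0 : (0 : ℝ) < p := by exact_mod_cast hpp.pos
  -- If `p` divides `n + 3` then `n ≥ 2`, exactly where `2 ^ n * (n + 3) ≤ 5 ^ n` begins to hold for
  -- good.
  have hv : 2 ^ n * p ^ padicValNat p (n + 3) ≤ p ^ n := by
    by_cases h0 : padicValNat p (n + 3) = 0
    · rw [h0, pow_zero, mul_one]; exact Nat.pow_le_pow_left (by omega) n
    have h1 : p ^ padicValNat p (n + 3) ≤ n + 3 :=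
      Nat.le_of_dvd (Nat.succ_pos _) pow_padicValNat_dvd
    have h3 : 5 ≤ n + 3 := by
      calc 5 ≤ p := hp
        _ = p ^ 1 := (pow_one p).symm
        _ ≤ p ^ padicValNat p (n + 3) := Nat.pow_le_pow_right hpp.pos (by omega)
        _ ≤ n + 3 := h1
    have h4 : 2 ^ n * (n + 3) ≤ 5 ^ n := by
      obtain ⟨t, rfl⟩ : ∃ t, n = t + 2 := ⟨n - 2, by omega⟩
      clear h0 h1 h3 hn
      induction t with
      | zero => norm_num
      | succ t ih =>
        rw [show t + 1 + 2 = (t + 2) + 1 by ring, pow_succ 2 (t + 2), pow_succ 5 (t + 2)]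
        nlinarith [Nat.pow_pos (n := t + 2) (show 0 < 2 by norm_num)]
    calc _ ≤ 2 ^ n * (n + 3) := by gcongr
      _ ≤ 5 ^ n := h4
      _ ≤ p ^ n := Nat.pow_le_pow_left hp n
  have hden : ‖(((n + 2 : ℕ) : ℚ_[p]) + 1)‖ = ((p : ℝ) ^ padicValNat p (n + 3))⁻¹ := by
    have h := Padic.norm_eq_zpow_neg_valuation hn
    have hc : (((n + 2 : ℕ) : ℚ_[p]) + 1) = ((n + 3 : ℕ) : ℚ_[p]) := by push_cast; ring
    rw [hc] at h ⊢
    rw [h, Padic.valuation_natCast, zpow_neg, zpow_natCast]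
  have hv' : (2 : ℝ) ^ n * (p : ℝ) ^ padicValNat p (n + 3) ≤ (p : ℝ) ^ n := by exact_mod_cast hv
  rw [norm_div, norm_pow, hden, div_inv_eq_mul, pow_add, mul_comm (‖y‖ ^ n), mul_assoc]
  refine mul_le_mul_of_nonneg_left ?_ (by positivity)
  calc ‖y‖ ^ n * (p : ℝ) ^ padicValNat p (n + 3)
      ≤ (p : ℝ)⁻¹ ^ n * (2⁻¹ ^ n * (p : ℝ) ^ n) := by
        gcongr
        rw [inv_pow, ← div_eq_inv_mul, le_div_iff₀ (by positivity), mul_comm]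
        exact hv'
    _ = 2⁻¹ ^ n := by
        rw [inv_pow (p : ℝ)]; field_simp

/-- Absolute convergence is wanted because this series of norms is the majorant for dominated
convergence in `tendsto_padicLogOneAdd`. -/
theorem padicLog_summable_norm {p : ℕ} [Fact p.Prime] (hp : 5 ≤ p) {y : ℚ_[p]}
    (hy : ‖y‖ ≤ (p : ℝ)⁻¹) :
    Summable fun n : ℕ => ‖y ^ (n + 1) / ((n : ℚ_[p]) + 1)‖ := by
  rw [← summable_nat_add_iff 2]
  refine Summable.of_nonneg_of_le (fun _ => norm_nonneg _) (padicLog_term_norm_le hp hy) ?_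
  exact (summable_geometric_of_lt_one (by norm_num) (by norm_num)).mul_left _

theorem padicLog_summable {p : ℕ} [Fact p.Prime] (hp : 5 ≤ p) {y : ℚ_[p]}
    (hy : ‖y‖ ≤ (p : ℝ)⁻¹) :
    Summable fun n : ℕ => (-1) ^ n * y ^ (n + 1) / ((n : ℚ_[p]) + 1) := by
  refine Summable.of_norm ((padicLog_summable_norm hp hy).congr fun n => ?_)
  simp [norm_div, norm_mul]

/-- The quadratic approximation of the `p`-adic logarithm. -/
theorem norm_padicLogOneAdd_sub_le {p : ℕ} [Fact p.Prime] (hp : 5 ≤ p) {y : ℚ_[p]}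
    (hy : ‖y‖ ≤ (p : ℝ)⁻¹) :
    ‖padicLogOneAdd p y - (y - y ^ 2 / 2)‖ ≤ ‖y‖ ^ 3 := by
  have h := (padicLog_summable hp hy).sum_add_tsum_nat_add 2
  rw [padicLogOneAdd, ← h, Finset.sum_range_succ, Finset.sum_range_one]
  have : ((-1) ^ 0 * y ^ (0 + 1) / (((0 : ℕ) : ℚ_[p]) + 1) +
      (-1) ^ 1 * y ^ (1 + 1) / (((1 : ℕ) : ℚ_[p]) + 1)) = y - y ^ 2 / 2 := by
    norm_num; ring
  rw [this, add_sub_cancel_left]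
  refine (IsUltrametricDist.norm_tsum_le _).trans (ciSup_le fun n => ?_)
  have := padicLog_term_norm_le hp hy n
  calc _ = ‖y ^ (n + 3) / (((n + 2 : ℕ) : ℚ_[p]) + 1)‖ := by
        simp [norm_div, norm_mul, add_assoc]
    _ ≤ ‖y‖ ^ 3 * 2⁻¹ ^ n := this
    _ ≤ ‖y‖ ^ 3 * 1 := by gcongr; exact pow_le_one₀ (by norm_num) (by norm_num)
    _ = _ := mul_one _

/-- Binomial coefficients are continuous on `ℤ_p`, `p ^ n - 1` tends to `-1`, and `-1` choose `i` is
`(-1) ^ i`. -/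
theorem tendsto_choose_prime_pow_sub_one (p : ℕ) [Fact p.Prime] (i : ℕ) :
    Tendsto (fun n : ℕ => (((p ^ n - 1).choose i : ℕ) : ℚ_[p])) atTop (𝓝 ((-1) ^ i)) := by
  have hp : p.Prime := Fact.out
  have h0 : Tendsto (fun n : ℕ => (p : ℤ_[p]) ^ n) atTop (𝓝 0) :=
    tendsto_pow_atTop_nhds_zero_of_norm_lt_one (by
      rw [PadicInt.norm_p]; exact inv_lt_one_of_one_lt₀ (by exact_mod_cast hp.one_lt))
  have h1 : Tendsto (fun n : ℕ => (p : ℤ_[p]) ^ n - 1) atTop (𝓝 (-1)) := by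
    simpa using h0.sub_const 1
  have h2 := ((PadicInt.continuous_choose (p := p) i).tendsto (-1)).comp h1
  have h3 : Ring.choose (-1 : ℤ_[p]) i = (-1) ^ i := by
    rw [Ring.choose_neg]
    simp [Int.negOnePow, Ring.choose_natCast, Units.smul_def, zsmul_eq_mul]
  rw [h3] at h2
  have h4 := ((continuous_subtype_val (p := fun x : ℚ_[p] => ‖x‖ ≤ 1)).tendsto
    ((-1 : ℤ_[p]) ^ i)).comp h2
  have e : (((-1 : ℤ_[p]) ^ i : ℤ_[p]) : ℚ_[p]) = (-1) ^ i := by push_cast; rfl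
  rw [e] at h4
  refine h4.congr fun n => ?_
  have : ((p : ℤ_[p]) ^ n - 1) = ((p ^ n - 1 : ℕ) : ℤ_[p]) := by
    rw [Nat.cast_sub (Nat.one_le_pow _ _ hp.pos)]; push_cast; rfl
  simp only [Function.comp, this, Ring.choose_natCast]
  exact PadicInt.coe_natCast _

/-- This form of the binomial theorem, at `N = p ^ n`, tends term by term to the logarithm series.
-/
theorem one_add_pow_sub_one_div {K : Type*} [Field K] [CharZero K] (y : K) {N : ℕ} (hN : N ≠ 0) :
    ((1 + y) ^ N - 1) / N =
      ∑ i ∈ Finset.range N, ((N - 1).choose i : K) * (y ^ (i + 1) / ((i : K) + 1)) := by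
  have hN' : (N : K) ≠ 0 := by exact_mod_cast hN
  rw [div_eq_iff hN', add_comm 1 y, add_pow, Finset.sum_range_succ', Finset.sum_mul]
  simp only [one_pow, mul_one, pow_zero, Nat.choose_zero_right, Nat.cast_one, add_sub_cancel_right]
  refine Finset.sum_congr rfl fun i _ => ?_
  obtain ⟨M, rfl⟩ : ∃ M, N = M + 1 := ⟨N - 1, by omega⟩
  have h := Nat.add_one_mul_choose_eq M i
  have h' : ((M : K) + 1) * (M.choose i : K) = ((M + 1).choose (i + 1) : K) * ((i : K) + 1) := by
    exact_mod_cast h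
  have hi : (i : K) + 1 ≠ 0 := by exact_mod_cast Nat.succ_ne_zero i
  rw [Nat.add_sub_cancel]
  push_cast
  field_simp
  linear_combination -y ^ (i + 1) * h'

/-- The `p`-adic logarithm as the limit of `((1 + y) ^ (p ^ n) - 1) / p ^ n`. -/
theorem tendsto_padicLogOneAdd {p : ℕ} [Fact p.Prime] (hp : 5 ≤ p) {y : ℚ_[p]}
    (hy : ‖y‖ ≤ (p : ℝ)⁻¹) :
    Tendsto (fun n : ℕ => ((1 + y) ^ (p ^ n) - 1) / ((p ^ n : ℕ) : ℚ_[p])) atTop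
      (𝓝 (padicLogOneAdd p y)) := by
  have hpp : p.Prime := Fact.out
  have h := tendsto_tsum_of_dominated_convergence (𝓕 := atTop)
    (f := fun (n : ℕ) (i : ℕ) =>
      (((p ^ n - 1).choose i : ℕ) : ℚ_[p]) * (y ^ (i + 1) / ((i : ℚ_[p]) + 1)))
    (g := fun i => (-1) ^ i * (y ^ (i + 1) / ((i : ℚ_[p]) + 1)))
    (padicLog_summable_norm hp hy)
    (fun i => (tendsto_choose_prime_pow_sub_one p i).mul_const _)
    (Eventually.of_forall fun n i => by
      rw [norm_mul]
      exact mul_le_of_le_one_left (norm_nonneg _)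
        (by exact_mod_cast Padic.norm_int_le_one (p := p) (((p ^ n - 1).choose i : ℕ) : ℤ)))
  have e : padicLogOneAdd p y = ∑' i : ℕ, (-1) ^ i * (y ^ (i + 1) / ((i : ℚ_[p]) + 1)) :=
    tsum_congr fun i => mul_div_assoc _ _ _
  rw [e]
  refine h.congr fun n => ?_
  rw [one_add_pow_sub_one_div y (pow_ne_zero n hpp.ne_zero)]
  refine tsum_eq_sum fun i hi => ?_
  rw [Finset.mem_range, not_lt] at hi
  rw [Nat.choose_eq_zero_of_lt, Nat.cast_zero, zero_mul]
  have := Nat.one_le_pow n p hpp.pos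
  omega

/-- The functional equation of the `p`-adic logarithm. -/
theorem padicLogOneAdd_mul {p : ℕ} [Fact p.Prime] (hp : 5 ≤ p) {y z : ℚ_[p]}
    (hy : ‖y‖ ≤ (p : ℝ)⁻¹) (hz : ‖z‖ ≤ (p : ℝ)⁻¹) :
    padicLogOneAdd p (y + z + y * z) = padicLogOneAdd p y + padicLogOneAdd p z := by
  have hpp : p.Prime := Fact.out
  have hp1 : (p : ℝ)⁻¹ ≤ 1 := inv_le_one_of_one_le₀ (by exact_mod_cast hpp.one_lt.le)
  have hyz : ‖y + z + y * z‖ ≤ (p : ℝ)⁻¹ := by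
    refine (IsUltrametricDist.norm_add_le_max _ _).trans (max_le ((IsUltrametricDist.norm_add_le_max _ _).trans
      (max_le hy hz)) ?_)
    rw [norm_mul]
    calc _ ≤ (p : ℝ)⁻¹ * 1 := by gcongr; exact hz.trans hp1
      _ = _ := mul_one _
  have ty := tendsto_padicLogOneAdd hp hy
  have tz := tendsto_padicLogOneAdd hp hz
  have h0 : Tendsto (fun n : ℕ => ((p ^ n : ℕ) : ℚ_[p])) atTop (𝓝 0) := by
    simp only [Nat.cast_pow]
    exact tendsto_pow_atTop_nhds_zero_of_norm_lt_one (by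
      rw [Padic.norm_p]; exact inv_lt_one_of_one_lt₀ (by exact_mod_cast hpp.one_lt))
  -- With `A y = ((1 + y) ^ (p ^ n) - 1) / p ^ n`, one has `A (y + z + y * z) = A y + A z + p ^ n *
  -- A y * A z`, and the last term vanishes in the limit.
  have tt := (ty.add tz).add ((ty.mul tz).mul h0)
  rw [mul_zero, add_zero] at tt
  refine tendsto_nhds_unique (tendsto_padicLogOneAdd hp hyz) (tt.congr fun n => ?_)
  have hn : ((p ^ n : ℕ) : ℚ_[p]) ≠ 0 := by exact_mod_cast pow_ne_zero n hpp.ne_zero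
  have : 1 + (y + z + y * z) = (1 + y) * (1 + z) := by ring
  rw [this, mul_pow]
  field_simp
  ring

/-- The linear term strictly dominates: 2 is a unit, so all that follows has norm at most `‖y‖ ^ 2 <
‖y‖`. -/
theorem norm_padicLogOneAdd {p : ℕ} [Fact p.Prime] (hp : 5 ≤ p) {y : ℚ_[p]}
    (hy : ‖y‖ ≤ (p : ℝ)⁻¹) : ‖padicLogOneAdd p y‖ = ‖y‖ := by
  have hpp : p.Prime := Fact.out
  rcases eq_or_ne y 0 with rfl | h0
  · have := norm_padicLogOneAdd_sub_le hp hy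
    simp only [norm_zero] at this ⊢
    have := this.trans_eq (zero_pow three_ne_zero)
    simpa using this
  have hy0 : 0 < ‖y‖ := norm_pos_iff.2 h0
  have hlt : ‖y‖ < 1 := hy.trans_lt (inv_lt_one_of_one_lt₀ (by exact_mod_cast hpp.one_lt))
  have h2 : ‖(2 : ℚ_[p])‖ = 1 := by
    have := (Padic.norm_natCast_eq_one_iff (p := p) (n := 2)).2
      ((Nat.coprime_primes hpp Nat.prime_two).2 (by omega))
    exact_mod_cast this
  have h1 : ‖padicLogOneAdd p y - y‖ < ‖y‖ := by
    have e : padicLogOneAdd p y - y = (padicLogOneAdd p y - (y - y ^ 2 / 2)) + (-(y ^ 2 / 2)) := by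
      ring
    rw [e]
    refine (IsUltrametricDist.norm_add_le_max _ _).trans_lt (max_lt ?_ ?_)
    · refine (norm_padicLogOneAdd_sub_le hp hy).trans_lt ?_
      exact pow_lt_self_of_lt_one₀ hy0 hlt (by norm_num)
    · rw [norm_neg, norm_div, h2, div_one, norm_pow]
      exact pow_lt_self_of_lt_one₀ hy0 hlt (by norm_num)
  have h3 := IsUltrametricDist.norm_add_eq_max_of_norm_ne_norm h1.ne
  rwa [sub_add_cancel, max_eq_right h1.le] at h3

/-- The `p`-adic logarithm is an isometry on `1 + p ℤ_p`. -/
theorem norm_padicLogOneAdd_sub {p : ℕ} [Fact p.Prime] (hp : 5 ≤ p) {y z : ℚ_[p]}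
    (hy : ‖y‖ ≤ (p : ℝ)⁻¹) (hz : ‖z‖ ≤ (p : ℝ)⁻¹) :
    ‖padicLogOneAdd p y - padicLogOneAdd p z‖ = ‖y - z‖ := by
  have hpp : p.Prime := Fact.out
  have hlt : ‖z‖ < 1 := hz.trans_lt (inv_lt_one_of_one_lt₀ (by exact_mod_cast hpp.one_lt))
  have h1 : ‖1 + z‖ = 1 := by
    rw [IsUltrametricDist.norm_add_eq_max_of_norm_ne_norm (by rw [norm_one]; exact hlt.ne'),
      norm_one, max_eq_left hlt.le]
  have h10 : 1 + z ≠ 0 := norm_ne_zero_iff.1 (by rw [h1]; exact one_ne_zero)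
  have hw : ‖(y - z) / (1 + z)‖ = ‖y - z‖ := by rw [norm_div, h1, div_one]
  have hyz : ‖y - z‖ ≤ (p : ℝ)⁻¹ := by
    rw [sub_eq_add_neg]
    exact (IsUltrametricDist.norm_add_le_max _ _).trans (max_le hy (by rwa [norm_neg]))
  -- This says `1 + y = (1 + z) * (1 + w)` with `w = (y - z) / (1 + z)`, so the two logarithms
  -- differ by that of `1 + w`.
  have e : y = z + (y - z) / (1 + z) + z * ((y - z) / (1 + z)) := by field_simp; ring
  have := padicLogOneAdd_mul hp hz (hw.trans_le hyz)
  rw [← e] at this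
  rw [this, add_sub_cancel_left, norm_padicLogOneAdd hp (hw.trans_le hyz), hw]

/-! ### The logarithm modulo `p ^ k` and the parameter of a character -/

theorem padic_norm_prime_mul_int_le {p : ℕ} [Fact p.Prime] (x : ℤ) :
    ‖(p : ℚ_[p]) * (x : ℚ_[p])‖ ≤ (p : ℝ)⁻¹ := by
  rw [norm_mul, Padic.norm_p]
  exact mul_le_of_le_one_right (by positivity) (Padic.norm_int_le_one x)

theorem toZModPow_eq_iff_norm_sub_le {p : ℕ} [Fact p.Prime] (k : ℕ) (a b : ℤ_[p]) :
    PadicInt.toZModPow k a = PadicInt.toZModPow k b ↔ ‖a - b‖ ≤ (p : ℝ) ^ (-(k : ℤ)) := by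
  rw [PadicInt.norm_le_pow_iff_mem_span_pow, ← PadicInt.ker_toZModPow, RingHom.mem_ker, map_sub,
    sub_eq_zero]

/-- The isometry read modulo `p ^ k`. It recovers a congruence of units from one of logarithms, with
no need for an exponential. -/
theorem toZModPow_padicIntLog_eq_iff {p : ℕ} [Fact p.Prime] (hp : 5 ≤ p) (k : ℕ) (x y : ℤ) :
    PadicInt.toZModPow k (padicIntLog p x) = PadicInt.toZModPow k (padicIntLog p y) ↔
      ((1 + (p : ℤ) * x : ℤ) : ZMod (p ^ k)) = ((1 + (p : ℤ) * y : ℤ) : ZMod (p ^ k)) := by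
  have e (t : ℤ) : ((1 + (p : ℤ) * t : ℤ) : ZMod (p ^ k)) =
      PadicInt.toZModPow k ((1 + (p : ℤ) * t : ℤ) : ℤ_[p]) := by rw [map_intCast]
  rw [e, e, toZModPow_eq_iff_norm_sub_le, toZModPow_eq_iff_norm_sub_le]
  have h := norm_padicLogOneAdd_sub hp (padic_norm_prime_mul_int_le (p := p) x)
    (padic_norm_prime_mul_int_le y)
  have h1 : ‖padicIntLog p x - padicIntLog p y‖ =
      ‖((1 + (p : ℤ) * x : ℤ) : ℤ_[p]) - ((1 + (p : ℤ) * y : ℤ) : ℤ_[p])‖ := by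
    rw [PadicInt.norm_def, PadicInt.norm_def]
    push_cast
    rw [add_sub_add_left_eq_sub]
    exact h
  rw [h1]

theorem padicIntLog_mul {p : ℕ} [Fact p.Prime] (hp : 5 ≤ p) (x y : ℤ) :
    padicIntLog p (x + y + p * x * y) = padicIntLog p x + padicIntLog p y := by
  apply Subtype.ext
  have := padicLogOneAdd_mul hp (padic_norm_prime_mul_int_le (p := p) x)
    (padic_norm_prime_mul_int_le y)
  rw [PadicInt.coe_add]
  change padicLogOneAdd p _ = padicLogOneAdd p _ + padicLogOneAdd p _
  rw [← this]
  congr 1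
  push_cast
  ring

theorem padicIntLog_zero {p : ℕ} [Fact p.Prime] (hp : 5 ≤ p) : padicIntLog p 0 = 0 := by
  have := padicIntLog_mul hp (p := p) 0 0
  simpa using this

/-- The logarithm of a power of `1 + p`. -/
theorem exists_padicIntLog_pow {p : ℕ} [Fact p.Prime] (hp : 5 ≤ p) (n : ℕ) :
    ∃ x : ℤ, 1 + (p : ℤ) * x = (1 + p) ^ n ∧ padicIntLog p x = n * padicIntLog p 1 := by
  induction n with
  | zero => exact ⟨0, by simp, by simp [padicIntLog_zero hp]⟩
  | succ n ih =>
    obtain ⟨x, hx, hl⟩ := ih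
    refine ⟨x + 1 + p * x * 1, ?_, ?_⟩
    · rw [pow_succ, ← hx]; ring
    · rw [padicIntLog_mul hp, hl]; push_cast; ring

theorem exists_padicIntLog_eq_mul {p : ℕ} [Fact p.Prime] (hp : 5 ≤ p) (x : ℤ) :
    ∃ c : ℤ_[p], padicIntLog p x = p * c ∧ ‖c‖ = ‖(x : ℤ_[p])‖ := by
  have hpp : p.Prime := Fact.out
  have h : ‖padicIntLog p x‖ = (p : ℝ)⁻¹ * ‖(x : ℤ_[p])‖ := by
    have := norm_padicLogOneAdd hp (padic_norm_prime_mul_int_le (p := p) x)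
    rw [norm_mul, Padic.norm_p] at this
    exact this
  have h1 : padicIntLog p x ∈ (Ideal.span {(p : ℤ_[p]) ^ 1} : Ideal ℤ_[p]) := by
    rw [← PadicInt.norm_le_pow_iff_mem_span_pow, h]
    simpa using mul_le_of_le_one_right (by positivity) (PadicInt.norm_le_one (x : ℤ_[p]))
  rw [pow_one, Ideal.mem_span_singleton] at h1
  obtain ⟨c, hc⟩ := h1
  refine ⟨c, hc, ?_⟩
  rw [hc, norm_mul, PadicInt.norm_p] at h
  exact mul_left_cancel₀ (inv_ne_zero (by exact_mod_cast hpp.ne_zero)) h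

theorem ZMod.prime_mul_eq_of_intCast_eq {p k : ℕ} (hk : 1 ≤ k) {a b : ℤ}
    (h : (a : ZMod (p ^ (k - 1))) = b) (c : ZMod (p ^ k)) :
    (a : ZMod (p ^ k)) * (p * c) = b * (p * c) := by
  rw [← mul_assoc, ← mul_assoc]
  congr 1
  rw [ZMod.intCast_eq_intCast_iff_dvd_sub] at h
  have : ((a * p : ℤ) : ZMod (p ^ k)) = ((b * p : ℤ) : ZMod (p ^ k)) := by
    rw [ZMod.intCast_eq_intCast_iff_dvd_sub, ← sub_mul]
    obtain ⟨d, rfl⟩ : ∃ d, k = d + 1 := ⟨k - 1, by omega⟩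
    rw [pow_succ, Nat.cast_mul]
    exact mul_dvd_mul_right h _
  exact_mod_cast this

/-- Any integer representative will do: the logarithm is divisible by `p`, which absorbs a change of
`ℓ` by a multiple of `p ^ (k - 1)`. -/
theorem isLogParam_intCast_iff {p k : ℕ} [Fact p.Prime] (hp : 5 ≤ p) (hk : 1 ≤ k)
    (χ : DirichletCharacter ℂ (p ^ k)) (ℓ : ℤ) :
    IsLogParam χ (ℓ : ZMod (p ^ (k - 1))) ↔ ∀ x : ℤ,
      χ (((1 + (p : ℤ) * x : ℤ)) : ZMod (p ^ k)) =
        ZMod.stdAddChar ((ℓ : ZMod (p ^ k)) * PadicInt.toZModPow k (padicIntLog p x)) := by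
  refine forall_congr' fun x => ?_
  obtain ⟨c, hc, -⟩ := exists_padicIntLog_eq_mul hp (p := p) x
  have := ZMod.prime_mul_eq_of_intCast_eq hk (a := ((ℓ : ZMod (p ^ (k - 1))).val : ℤ)) (b := ℓ)
    (by simp) (PadicInt.toZModPow k c)
  rw [hc, map_mul (PadicInt.toZModPow k), map_natCast, ← this]
  simp

/-- As `log (1 + p)` is `p` times a unit `v`, every `1 + p * x` is a power of `1 + p` modulo `p ^
k`, so `χ (1 + p)` decides everything. It is a `p ^ (k - 1)`-th root of unity `e_{p^k} (c * p)`,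
whence `ℓ = c / v`. -/
theorem existsUnique_isLogParam {p k : ℕ} [Fact p.Prime] (hp : 5 ≤ p) (hk : 1 ≤ k)
    (χ : DirichletCharacter ℂ (p ^ k)) :
    ∃! a : ZMod (p ^ (k - 1)), IsLogParam χ a := by
  have hpp : p.Prime := Fact.out
  obtain ⟨w, hw, hw1⟩ := exists_padicIntLog_eq_mul hp (p := p) 1
  rw [Int.cast_one, norm_one, ← PadicInt.isUnit_iff] at hw1
  have hwu : IsUnit (PadicInt.toZModPow k w) := hw1.map _
  set v := PadicInt.toZModPow k w with hv
  have hlog1 : PadicInt.toZModPow k (padicIntLog p 1) = p * v := by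
    rw [hw, map_mul, map_natCast]
  obtain ⟨b, hb⟩ := hwu.exists_right_inv
  refine existsUnique_of_exists_of_unique ?_ ?_
  · have hpow (n : ℕ) (x : ℤ)
        (hx : PadicInt.toZModPow k (padicIntLog p x) = n * (p * v)) :
        ((1 + (p : ℤ) * x : ℤ) : ZMod (p ^ k)) = ((1 + (p : ℤ) : ℤ) : ZMod (p ^ k)) ^ n := by
      obtain ⟨X, hX, hl⟩ := exists_padicIntLog_pow hp (p := p) n
      rw [← Int.cast_pow, ← hX, ← toZModPow_padicIntLog_eq_iff hp, hx, hl, map_mul, map_natCast,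
        hlog1]
    have hg : ((1 + (p : ℤ) : ℤ) : ZMod (p ^ k)) ^ (p ^ (k - 1)) = 1 := by
      rw [← hpow (p ^ (k - 1)) 0]
      · simp
      · rw [padicIntLog_zero hp, map_zero, ← mul_assoc, ← Nat.cast_mul, ← pow_succ,
          Nat.sub_add_cancel hk, ZMod.natCast_self, zero_mul]
    have hχg : χ ((1 + (p : ℤ) : ℤ) : ZMod (p ^ k)) ^ (p ^ (k - 1)) = 1 := by
      rw [← map_pow, hg, map_one]
    obtain ⟨c, -, hc⟩ := (Complex.isPrimitiveRoot_exp (p ^ (k - 1))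
      (pow_ne_zero _ hpp.ne_zero)).eq_pow_of_pow_eq_one hχg
    have hc' : χ ((1 + (p : ℤ) : ℤ) : ZMod (p ^ k)) =
        ZMod.stdAddChar ((c : ZMod (p ^ k)) * (p : ZMod (p ^ k))) := by
      rw [← hc, ← Complex.exp_nat_mul]
      have := ZMod.stdAddChar_coe (N := p ^ k) (c * p)
      push_cast at this
      rw [this]
      congr 1
      have hp0 : (p : ℂ) ≠ 0 := by exact_mod_cast hpp.ne_zero
      obtain ⟨d, rfl⟩ : ∃ d, k = d + 1 := ⟨k - 1, by omega⟩
      rw [Nat.add_sub_cancel, pow_succ]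
      push_cast
      field_simp
    refine ⟨((((c : ZMod (p ^ k)) * b).val : ℤ) : ZMod (p ^ (k - 1))), ?_⟩
    rw [isLogParam_intCast_iff hp hk]
    intro x
    obtain ⟨d, hd, -⟩ := exists_padicIntLog_eq_mul hp (p := p) x
    -- With `log (1 + p * x) = p * d`, the exponent of `1 + p` that produces `1 + p * x` is `d / v`.
    have hx : PadicInt.toZModPow k (padicIntLog p x) =
        (((PadicInt.toZModPow k d * b).val : ℕ) : ZMod (p ^ k)) * (p * v) := by
      rw [hd, map_mul, map_natCast, ZMod.natCast_val, ZMod.cast_id', id]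
      linear_combination (-(p : ZMod (p ^ k)) * PadicInt.toZModPow k d) * hb
    rw [hpow _ x hx, map_pow, hc', ← AddChar.map_nsmul_eq_pow, hx]
    congr 1
    rw [nsmul_eq_mul, Int.cast_natCast]
    simp only [ZMod.natCast_val, ZMod.cast_id', id]
    linear_combination (-PadicInt.toZModPow k d * b * c * p) * hb
  · intro a a' ha ha'
    have h := (ha 1).symm.trans (ha' 1)
    have h := ZMod.injective_stdAddChar h
    rw [hlog1, ← mul_assoc, ← mul_assoc, hwu.mul_left_inj] at h
    have h : ((a.val * p : ℕ) : ZMod (p ^ k)) = ((a'.val * p : ℕ) : ZMod (p ^ k)) := by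
      exact_mod_cast h
    rw [ZMod.natCast_eq_natCast_iff] at h
    obtain ⟨d, rfl⟩ : ∃ d, k = d + 1 := ⟨k - 1, by omega⟩
    rw [pow_succ] at h
    have h := Nat.ModEq.mul_right_cancel' hpp.ne_zero h
    rw [← ZMod.natCast_eq_natCast_iff] at h
    simpa using h

/-- The quadratic approximation of the logarithm modulo `p ^ k`. -/
theorem two_mul_toZModPow_padicIntLog {p : ℕ} [Fact p.Prime] (hp : 5 ≤ p) {k j : ℕ} (hj : 1 ≤ j)
    (hkj : k ≤ 3 * j) (u : ℤ) :
    2 * PadicInt.toZModPow k (padicIntLog p ((p : ℤ) ^ (j - 1) * u)) =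
      ((2 * (p : ℤ) ^ j * u - ((p : ℤ) ^ j * u) ^ 2 : ℤ) : ZMod (p ^ k)) := by
  have hpp : p.Prime := Fact.out
  have e : ((2 * (p : ℤ) ^ j * u - ((p : ℤ) ^ j * u) ^ 2 : ℤ) : ZMod (p ^ k)) =
      PadicInt.toZModPow k ((2 * (p : ℤ) ^ j * u - ((p : ℤ) ^ j * u) ^ 2 : ℤ) : ℤ_[p]) := by
    rw [map_intCast]
  rw [e, ← map_ofNat (PadicInt.toZModPow k) 2, ← map_mul, toZModPow_eq_iff_norm_sub_le,
    PadicInt.norm_def]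
  have hy := padic_norm_prime_mul_int_le (p := p) ((p : ℤ) ^ (j - 1) * u)
  have hl := norm_padicLogOneAdd_sub_le hp hy
  set y : ℚ_[p] := (p : ℚ_[p]) * (((p : ℤ) ^ (j - 1) * u : ℤ) : ℚ_[p]) with hydef
  have hyj : y = (p : ℚ_[p]) ^ j * u := by
    rw [hydef]; push_cast
    rw [← mul_assoc, ← pow_succ', Nat.sub_add_cancel hj]
  have h2 : ‖(2 : ℚ_[p])‖ ≤ 1 := by exact_mod_cast Padic.norm_int_le_one (p := p) 2
  have e2 : ((2 * padicIntLog p ((p : ℤ) ^ (j - 1) * u) -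
      ((2 * (p : ℤ) ^ j * u - ((p : ℤ) ^ j * u) ^ 2 : ℤ) : ℤ_[p]) : ℤ_[p]) : ℚ_[p]) =
      2 * (padicLogOneAdd p y - (y - y ^ 2 / 2)) := by
    push_cast
    rw [hyj] at hydef ⊢
    change 2 * padicLogOneAdd p _ - _ = _
    rw [← hydef]
    rw [show ((2 : ℤ_[p]) : ℚ_[p]) = 2 from rfl]
    ring
  rw [e2, norm_mul]
  calc _ ≤ 1 * ‖y‖ ^ 3 := by gcongr
    _ = ‖(p : ℚ_[p]) ^ j * u‖ ^ 3 := by rw [one_mul, hyj]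
    _ ≤ ((p : ℝ)⁻¹ ^ j * 1) ^ 3 := by
      rw [norm_mul, norm_pow, Padic.norm_p]
      gcongr
      exact Padic.norm_int_le_one u
    _ = (p : ℝ) ^ (-((3 * j : ℕ) : ℤ)) := by
      rw [mul_one, ← pow_mul, zpow_neg, zpow_natCast, inv_pow, mul_comm]
    -- Here `k ≤ 3 * j` makes the cubic remainder vanish modulo `p ^ k`.
    _ ≤ _ := by
      apply zpow_le_zpow_right₀ (by exact_mod_cast hpp.one_lt.le)
      omega

end PadicLog

/-! ### Additive characters and complete sums -/

section ExponentialSums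

open Finset

/-- `expMod N a = exp (2 π i a / N)`. -/
noncomputable def expMod (N : ℕ) (a : ℤ) : ℂ :=
  Complex.exp (2 * Real.pi * Complex.I * a / N)

theorem stdAddChar_intCast (N : ℕ) [NeZero N] (a : ℤ) :
    ZMod.stdAddChar (a : ZMod N) = expMod N a :=
  ZMod.stdAddChar_coe a

theorem expMod_add (N : ℕ) (a b : ℤ) : expMod N (a + b) = expMod N a * expMod N b := by
  rw [expMod, expMod, expMod, ← Complex.exp_add]
  congr 1
  push_cast
  ring

theorem expMod_zero (N : ℕ) : expMod N 0 = 1 := by simp [expMod]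

theorem expMod_congr {N : ℕ} [NeZero N] {a b : ℤ} (h : (N : ℤ) ∣ b - a) :
    expMod N a = expMod N b := by
  rw [← stdAddChar_intCast, ← stdAddChar_intCast, (ZMod.intCast_eq_intCast_iff_dvd_sub a b N).2 h]

theorem expMod_mul_mul {N M : ℕ} (hM : M ≠ 0) (a : ℤ) : expMod (N * M) (M * a) = expMod N a := by
  have : (M : ℂ) ≠ 0 := by exact_mod_cast hM
  rw [expMod, expMod]
  congr 1
  push_cast
  rw [mul_comm (N : ℂ), mul_left_comm, mul_div_mul_left _ _ this]

theorem expMod_pow (N : ℕ) (a : ℤ) (n : ℕ) : expMod N a ^ n = expMod N (a * n) := by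
  rw [expMod, expMod, ← Complex.exp_nat_mul]
  congr 1
  push_cast
  ring

theorem sum_range_eq_sum_zmod {R : Type*} [AddCommMonoid R] (N : ℕ) [NeZero N]
    (g : ZMod N → R) : ∑ v ∈ range N, g (v : ZMod N) = ∑ z, g z := by
  refine sum_bij' (fun v _ => (v : ZMod N)) (fun z _ => z.val) (fun _ _ => mem_univ _)
    (fun z _ => mem_range.2 z.val_lt) (fun v hv => ?_) (fun z _ => ?_) (fun _ _ => rfl)
  · exact ZMod.val_cast_of_lt (mem_range.1 hv)
  · simp

theorem sum_range_mul_eq {R : Type*} [AddCommMonoid R] (A B : ℕ) (f : ℕ → R) :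
    ∑ v ∈ range (A * B), f v = ∑ x ∈ range A, ∑ y ∈ range B, f (x + A * y) := by
  rw [sum_comm]
  induction B with
  | zero => simp
  | succ B ih =>
    rw [Nat.mul_succ, sum_range_add, ih, sum_range_succ]
    simp only [add_comm]

theorem sum_range_expMod_mul (N : ℕ) [NeZero N] (c : ℤ) :
    ∑ y ∈ range N, expMod N (c * y) = if (N : ℤ) ∣ c then (N : ℂ) else 0 := by
  have h := AddChar.sum_mulShift (c : ZMod N) (ZMod.isPrimitive_stdAddChar N)
  simp only [ZMod.card, ZMod.intCast_zmod_eq_zero_iff_dvd, Nat.cast_ite, Nat.cast_zero] at h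
  rw [← h, ← sum_range_eq_sum_zmod]
  refine sum_congr rfl fun y _ => ?_
  rw [← stdAddChar_intCast]
  push_cast
  rw [mul_comm]

/-- The quadratic Gauss sum `∑_{v mod N} e_N(a v ^ 2)`. -/
noncomputable def quadGaussSum (N : ℕ) (a : ℤ) : ℂ := ∑ v ∈ range N, expMod N (a * (v : ℤ) ^ 2)

theorem quadGaussSum_eq_sum_zmod (N : ℕ) [NeZero N] (a : ℤ) :
    quadGaussSum N a = ∑ z : ZMod N, ZMod.stdAddChar ((a : ZMod N) * z ^ 2) := by
  rw [quadGaussSum, ← sum_range_eq_sum_zmod]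
  refine sum_congr rfl fun v _ => ?_
  rw [← stdAddChar_intCast]
  push_cast
  rfl

/-- The Gaussian binomial coefficient `[i + j, j]` at the parameter `q`. -/
def gaussBinom {R : Type*} [CommRing R] (q : R) : ℕ → ℕ → R
  | 0, _ => 1
  | _ + 1, 0 => 1
  | i + 1, j + 1 => gaussBinom q i (j + 1) + q ^ (i + 1) * gaussBinom q (i + 1) j

/-! ### Gaussian binomial coefficients -/

section GaussBinom

variable {R : Type*} [CommRing R] (q : R)

theorem gaussBinom_zero_left (j : ℕ) : gaussBinom q 0 j = 1 := by rw [gaussBinom]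

theorem gaussBinom_zero_right (i : ℕ) : gaussBinom q i 0 = 1 := by
  cases i <;> rw [gaussBinom]

theorem gaussBinom_succ_succ (i j : ℕ) : gaussBinom q (i + 1) (j + 1) =
    gaussBinom q i (j + 1) + q ^ (i + 1) * gaussBinom q (i + 1) j := by
  rw [gaussBinom]

/-- The left and right absorption identities are proved by one interlaced induction on `i`. They are
kept free of division, since `1 - q ^ n` may vanish. -/
theorem gaussBinom_succ_left_of (i : ℕ)
    (h : ∀ j, (1 - q ^ (j + 1)) * gaussBinom q i (j + 1) =
      (1 - q ^ (i + j + 1)) * gaussBinom q i j) (j : ℕ) :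
    (1 - q ^ (i + 1)) * gaussBinom q (i + 1) j = (1 - q ^ (i + j + 1)) * gaussBinom q i j := by
  induction j with
  | zero => simp [gaussBinom_zero_right]
  | succ j ih =>
    rw [gaussBinom_succ_succ]
    linear_combination q ^ (i + 1) * ih - q ^ (i + 1) * h j

theorem one_sub_pow_mul_gaussBinom_right (i j : ℕ) :
    (1 - q ^ (j + 1)) * gaussBinom q i (j + 1) = (1 - q ^ (i + j + 1)) * gaussBinom q i j := by
  induction i generalizing j with
  | zero => simp [gaussBinom_zero_left]
  | succ i ih =>
    rw [gaussBinom_succ_succ]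
    linear_combination ih j - gaussBinom_succ_left_of q i ih j

theorem one_sub_pow_mul_gaussBinom_left (i j : ℕ) :
    (1 - q ^ (i + 1)) * gaussBinom q (i + 1) j = (1 - q ^ (i + j + 1)) * gaussBinom q i j :=
  gaussBinom_succ_left_of q i (one_sub_pow_mul_gaussBinom_right q i) j

/-- After Pascal's rule, the leftover sums are the alternating sum for `m + 1` peeled at either end,
so they cancel; absorption turns the rest into the factor `1 - q ^ (m + 1)`. -/
theorem sum_gaussBinom_add_two (m : ℕ) :
    ∑ x ∈ antidiagonal (m + 2), (-1) ^ x.2 * gaussBinom q x.1 x.2 =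
      (1 - q ^ (m + 1)) * ∑ x ∈ antidiagonal m, (-1) ^ x.2 * gaussBinom q x.1 x.2 := by
  have h1 : ∑ x ∈ antidiagonal (m + 1), (-1) ^ x.2 * gaussBinom q x.1 x.2 =
      (-1) ^ (m + 1) + ∑ x ∈ antidiagonal m, (-1) ^ x.2 * gaussBinom q (x.1 + 1) x.2 := by
    rw [Nat.sum_antidiagonal_succ]
    simp [gaussBinom_zero_left]
  have h2 : ∑ x ∈ antidiagonal (m + 1), (-1) ^ x.2 * gaussBinom q x.1 x.2 =
      1 + ∑ x ∈ antidiagonal m, (-1) ^ (x.2 + 1) * gaussBinom q x.1 (x.2 + 1) := by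
    rw [Nat.sum_antidiagonal_succ']
    simp [gaussBinom_zero_right]
  rw [Nat.sum_antidiagonal_succ, Nat.sum_antidiagonal_succ']
  simp only [gaussBinom_zero_left, gaussBinom_zero_right, gaussBinom_succ_succ]
  have h3 : ∑ x ∈ antidiagonal m, (1 - q ^ (x.1 + 1)) * ((-1) ^ x.2 * gaussBinom q (x.1 + 1) x.2) =
      (1 - q ^ (m + 1)) * ∑ x ∈ antidiagonal m, (-1) ^ x.2 * gaussBinom q x.1 x.2 := by
    rw [mul_sum]
    refine sum_congr rfl fun x hx => ?_
    have := one_sub_pow_mul_gaussBinom_left q x.1 x.2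
    rw [mem_antidiagonal.1 hx] at this
    linear_combination (-1) ^ x.2 * this
  rw [← h3]
  have h4 : ∑ x ∈ antidiagonal m, (-1) ^ (x.2 + 1) *
      (gaussBinom q x.1 (x.2 + 1) + q ^ (x.1 + 1) * gaussBinom q (x.1 + 1) x.2) =
      ∑ x ∈ antidiagonal m, (-1) ^ (x.2 + 1) * gaussBinom q x.1 (x.2 + 1) +
      (∑ x ∈ antidiagonal m, (1 - q ^ (x.1 + 1)) * ((-1) ^ x.2 * gaussBinom q (x.1 + 1) x.2) -
        ∑ x ∈ antidiagonal m, (-1) ^ x.2 * gaussBinom q (x.1 + 1) x.2) := by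
    rw [← sum_sub_distrib, ← sum_add_distrib]
    refine sum_congr rfl fun x _ => ?_
    ring
  rw [h4]
  linear_combination h1 - h2

/-- Gauss's evaluation of the alternating sum of Gaussian binomial coefficients. -/
theorem sum_gaussBinom_two_mul (n : ℕ) :
    ∑ x ∈ antidiagonal (2 * n), (-1) ^ x.2 * gaussBinom q x.1 x.2 =
      ∏ t ∈ range n, (1 - q ^ (2 * t + 1)) := by
  induction n with
  | zero => simp [gaussBinom_zero_left]
  | succ n ih => rw [Nat.mul_succ, sum_gaussBinom_add_two, ih, prod_range_succ, mul_comm]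

end GaussBinom

/-! ### Evaluation of quadratic Gauss sums -/

/-- With `q = ζ⁻¹ ^ 2`, consecutive values have ratio `(1 - q ^ (i + 1)) / (1 - q ^ (j + 1))`. Since
`(i + 1) + (j + 1) = N`, this is `-ζ ^ (2 * (j + 1))`; oddness of `N` keeps the denominator nonzero.
-/
theorem gaussBinom_root_of_unity {K : Type*} [Field K] {ζ : K} {N : ℕ} (hζ : IsPrimitiveRoot ζ N)
    (hN : Odd N) (i j : ℕ) (hij : i + j + 1 = N) :
    gaussBinom (ζ⁻¹ ^ 2) i j = (-1) ^ j * ζ ^ (j * (j + 1)) := by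
  have hζ0 : ζ ≠ 0 := hζ.ne_zero (by omega)
  induction j generalizing i with
  | zero => simp [gaussBinom_zero_right]
  | succ j ih =>
    have h := ih (i + 1) (by omega)
    have h1 := one_sub_pow_mul_gaussBinom_right (ζ⁻¹ ^ 2) i j
    rw [← one_sub_pow_mul_gaussBinom_left, h] at h1
    have hne : 1 - (ζ⁻¹ ^ 2) ^ (j + 1) ≠ 0 := by
      rw [sub_ne_zero, ← pow_mul, ne_comm, ne_eq, hζ.inv.pow_eq_one_iff_dvd]
      intro hd
      have := (Nat.Coprime.dvd_of_dvd_mul_left (Nat.coprime_two_right.2 hN) hd)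
      have := Nat.le_of_dvd (by omega) this
      omega
    apply mul_left_cancel₀ hne
    rw [h1]
    have e1 : (ζ⁻¹ ^ 2) ^ (i + 1) = ζ ^ (2 * (j + 1)) := by
      rw [← pow_mul, inv_pow, inv_eq_iff_eq_inv]
      apply eq_inv_of_mul_eq_one_left
      rw [← pow_add, show 2 * (i + 1) + 2 * (j + 1) = N * 2 by omega, pow_mul, hζ.pow_eq_one,
        one_pow]
    have e2 : (ζ⁻¹ ^ 2) ^ (j + 1) * ζ ^ (2 * (j + 1)) = 1 := by
      rw [← pow_mul, ← mul_pow, inv_mul_cancel₀ hζ0, one_pow]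
    have e3 : ζ ^ ((j + 1) * (j + 1 + 1)) = ζ ^ (j * (j + 1)) * ζ ^ (2 * (j + 1)) := by
      rw [← pow_add]; ring_nf
    rw [e1, e3, pow_succ]
    linear_combination (-(-1) ^ j * ζ ^ (j * (j + 1))) * e2

theorem sum_root_of_unity_pow {K : Type*} [Field K] {ζ : K} {n : ℕ}
    (hζ : IsPrimitiveRoot ζ (2 * n + 1)) :
    ∑ j ∈ range (2 * n + 1), ζ ^ (j * (j + 1)) =
      ∏ t ∈ range n, (1 - (ζ⁻¹ ^ 2) ^ (2 * t + 1)) := by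
  rw [← sum_gaussBinom_two_mul, ← Nat.sum_antidiagonal_swap,
    Nat.sum_antidiagonal_eq_sum_range_succ_mk]
  refine sum_congr rfl fun j hj => ?_
  have hj := mem_range.1 hj
  rw [Prod.swap_prod_mk, gaussBinom_root_of_unity hζ ⟨n, rfl⟩ _ _ (by omega), ← mul_assoc,
    ← mul_pow, neg_one_mul, neg_neg, one_pow, one_mul]

theorem sum_range_shift {R : Type*} [AddCommMonoid R] (N : ℕ) [NeZero N] (g : ZMod N → R)
    (c : ZMod N) : ∑ v ∈ range N, g (v + c) = ∑ v ∈ range N, g v := by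
  rw [sum_range_eq_sum_zmod N fun z => g (z + c), sum_range_eq_sum_zmod]
  exact Equiv.sum_comp (Equiv.addRight c) g

theorem sum_range_odd_eq_sq (n : ℕ) : ∑ t ∈ range n, (2 * t + 1) = n ^ 2 := by
  induction n with
  | zero => simp
  | succ n ih => rw [sum_range_succ, ih]; ring

/-- Gauss's product formula for the quadratic Gauss sum of odd modulus. -/
theorem quadGaussSum_one_eq_prod (n : ℕ) :
    quadGaussSum (2 * n + 1) 1 =
      ∏ t ∈ range n, (2 * Complex.I *
        (Real.sin (2 * Real.pi * (2 * t + 1) / (2 * n + 1)) : ℝ)) := by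
  set N := 2 * n + 1 with hN
  set ζ : ℂ := expMod N 1 with hζdef
  have hζ : IsPrimitiveRoot ζ N := by
    have := Complex.isPrimitiveRoot_exp N (by omega)
    rwa [hζdef, expMod, Int.cast_one, mul_one]
  have hζ0 : ζ ≠ 0 := hζ.ne_zero (by omega)
  have hpow (a : ℕ) : expMod N a = ζ ^ a := by rw [hζdef, expMod_pow, one_mul]
  have h1 := sum_root_of_unity_pow hζ
  -- The shift `n + 1` is one half modulo `N`, so `(v + n + 1) ^ 2 ≡ v * (v + 1) + (n + 1) ^ 2`.
  have h2 : quadGaussSum N 1 = ζ ^ ((n + 1) ^ 2) * ∑ j ∈ range N, ζ ^ (j * (j + 1)) := by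
    have h := sum_range_shift N (fun z => ZMod.stdAddChar (z ^ 2)) ((n + 1 : ℕ) : ZMod N)
    rw [quadGaussSum]
    calc _ = ∑ v ∈ range N, ZMod.stdAddChar ((v : ZMod N) ^ 2) := by
          refine sum_congr rfl fun v _ => ?_
          rw [← stdAddChar_intCast]
          push_cast
          rw [one_mul]
      _ = _ := by
          rw [← h, mul_sum]
          refine sum_congr rfl fun v _ => ?_
          rw [← pow_add, ← hpow]
          have e := stdAddChar_intCast N (((v : ℤ) + ((n + 1 : ℕ) : ℤ)) ^ 2)
          push_cast at e ⊢
          rw [e]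
          apply expMod_congr
          rw [hN]
          exact ⟨-v, by push_cast; ring⟩
  have h3 (t : ℕ) : 1 - (ζ⁻¹ ^ 2) ^ (2 * t + 1) = ζ⁻¹ ^ (2 * t + 1) * (2 * Complex.I *
        (Real.sin (2 * Real.pi * (2 * t + 1) / (2 * n + 1)) : ℝ)) := by
    have e1 : (2 * Complex.I * (Real.sin (2 * Real.pi * (2 * t + 1) / (2 * n + 1)) : ℝ)) =
        ζ ^ (2 * t + 1) - ζ⁻¹ ^ (2 * t + 1) := by
      rw [inv_pow, ← hpow, expMod, ← Complex.exp_neg, Complex.ofReal_sin, Complex.sin]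
      push_cast
      have a1 : -(2 * (Real.pi : ℂ) * (2 * t + 1) / (2 * n + 1)) * Complex.I =
        -(2 * Real.pi * Complex.I * (2 * t + 1) / (2 * n + 1)) := by ring
      have a2 : (2 * (Real.pi : ℂ) * (2 * t + 1) / (2 * n + 1)) * Complex.I =
        (2 * Real.pi * Complex.I * (2 * t + 1) / (2 * n + 1)) := by ring
      rw [hN, a1, a2]
      push_cast
      linear_combination (Complex.exp (-(2 * Real.pi * Complex.I * (2 * t + 1) / (2 * n + 1))) -
        Complex.exp (2 * Real.pi * Complex.I * (2 * t + 1) / (2 * n + 1))) * Complex.I_mul_I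
    rw [e1, mul_sub, ← mul_pow, inv_mul_cancel₀ hζ0, one_pow]
    ring
  have h4 : ∏ t ∈ range n, ζ⁻¹ ^ (2 * t + 1) = ζ⁻¹ ^ (n ^ 2) := by
    rw [prod_pow_eq_pow_sum, sum_range_odd_eq_sq]
  rw [h2, h1, prod_congr rfl fun t _ => h3 t, prod_mul_distrib, h4, ← mul_assoc]
  have e : (n + 1) ^ 2 = N + n ^ 2 := by rw [hN]; ring
  rw [e, pow_add, hζ.pow_eq_one, one_mul, ← mul_pow, mul_inv_cancel₀ hζ0, one_pow, one_mul]

/-- The sine is positive when `2 * t + 1 ≤ n` and negative for the remaining `n / 2` (rounded down)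
values of `t`. -/
theorem quadGaussSum_one_eq_sign_mul (n : ℕ) :
    ∃ r : ℝ, 0 < r ∧ quadGaussSum (2 * n + 1) 1 = Complex.I ^ n * (-1) ^ (n / 2) * r := by
  set s : ℕ → ℝ := fun t => 2 * Real.sin (2 * Real.pi * (2 * t + 1) / (2 * n + 1)) with hs
  have h : quadGaussSum (2 * n + 1) 1 = Complex.I ^ n * ((∏ t ∈ range n, s t : ℝ) : ℂ) := by
    have hI : Complex.I ^ n = ∏ _t ∈ range n, Complex.I := by rw [prod_const, card_range]
    rw [quadGaussSum_one_eq_prod, Complex.ofReal_prod, hI, ← prod_mul_distrib]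
    refine prod_congr rfl fun t _ => ?_
    rw [hs]
    push_cast
    ring
  have hpi := Real.pi_pos
  have hn : (0 : ℝ) < 2 * n + 1 := by positivity
  have hpos (t : ℕ) (ht : t ∈ range (n - n / 2)) : 0 < s t := by
    have ht := mem_range.1 ht
    have ht' : (2 * t + 1 : ℝ) ≤ n := by exact_mod_cast (show 2 * t + 1 ≤ n by omega)
    refine mul_pos two_pos (Real.sin_pos_of_pos_of_lt_pi (by positivity) ?_)
    rw [div_lt_iff₀ hn]
    nlinarith
  have hneg (t : ℕ) (ht : t ∈ range (n / 2)) : 0 < -s (n - n / 2 + t) := by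
    have ht := mem_range.1 ht
    have h1 : (n + 1 : ℝ) ≤ 2 * ((n - n / 2 + t : ℕ) : ℝ) + 1 := by
      exact_mod_cast (show n + 1 ≤ 2 * (n - n / 2 + t) + 1 by omega)
    have h2 : 2 * ((n - n / 2 + t : ℕ) : ℝ) + 1 ≤ 2 * n := by
      exact_mod_cast (show 2 * (n - n / 2 + t) + 1 ≤ 2 * n by omega)
    generalize n - n / 2 + t = T at h1 h2
    simp only [hs]
    rw [← mul_neg, ← Real.sin_sub_pi]
    refine mul_pos two_pos (Real.sin_pos_of_pos_of_lt_pi ?_ ?_)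
    · rw [sub_pos, lt_div_iff₀ hn]
      nlinarith
    · rw [sub_lt_iff_lt_add, div_lt_iff₀ hn]
      nlinarith
  refine ⟨(∏ t ∈ range (n - n / 2), s t) * ∏ t ∈ range (n / 2), -s (n - n / 2 + t),
    mul_pos (prod_pos hpos) (prod_pos hneg), ?_⟩
  rw [h, prod_neg, card_range]
  have : ∏ t ∈ range n, s t = (∏ t ∈ range (n - n / 2), s t) *
      ∏ t ∈ range (n / 2), s (n - n / 2 + t) := by
    rw [← prod_range_add, Nat.sub_add_cancel (Nat.div_le_self n 2)]
  rw [this]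
  push_cast
  have e : ((-1 : ℂ) ^ (n / 2)) * (-1) ^ (n / 2) = 1 := by
    rw [← mul_pow]; simp
  linear_combination (-Complex.I ^ n * (∏ t ∈ range (n - n / 2), (s t : ℂ)) *
    ∏ t ∈ range (n / 2), (s (n - n / 2 + t) : ℂ)) * e

/-- Each `w` has `1 + χ w` square roots for the quadratic character `χ`, and the constant 1
contributes a vanishing sum. -/
theorem quadGaussSum_prime_eq_gaussSum {p : ℕ} [Fact p.Prime] (hp : p ≠ 2) {a : ℤ}
    (ha : (a : ZMod p) ≠ 0) :
    quadGaussSum p a = (jacobiSym a p : ℂ) *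
      gaussSum ((quadraticChar (ZMod p)).ringHomComp (Int.castRingHom ℂ)) ZMod.stdAddChar := by
  have hF : ringChar (ZMod p) ≠ 2 := by rwa [ZMod.ringChar_zmod_n]
  set χ := (quadraticChar (ZMod p)).ringHomComp (Int.castRingHom ℂ) with hχ
  have h1 : quadGaussSum p a = gaussSum χ (ZMod.stdAddChar.mulShift (a : ZMod p)) := by
    have h0 : ∑ w : ZMod p, ZMod.stdAddChar ((a : ZMod p) * w) = 0 := by
      have := AddChar.sum_mulShift (a : ZMod p) (ZMod.isPrimitive_stdAddChar p)
      rw [if_neg ha, Nat.cast_zero] at this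
      rw [← this]
      exact sum_congr rfl fun w _ => by rw [mul_comm]
    rw [quadGaussSum_eq_sum_zmod,
      ← sum_fiberwise (g := fun z : ZMod p => z ^ 2), gaussSum,
      ← add_zero (∑ w, χ w * _), ← h0, ← sum_add_distrib]
    refine sum_congr rfl fun w _ => ?_
    have hc := quadraticChar_card_sqrts hF w
    have hc' : ((#{z : ZMod p | z ^ 2 = w} : ℤ) : ℂ) = χ w + 1 := by
      rw [hχ, MulChar.ringHomComp_apply]
      have : #{z : ZMod p | z ^ 2 = w} = #{x : ZMod p | x ^ 2 = w}.toFinset := by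
        congr 1; ext; simp
      rw [this, hc]
      simp
    rw [sum_congr rfl (g := fun _ => ZMod.stdAddChar ((a : ZMod p) * w))
      (fun z hz => by rw [(mem_filter.1 hz).2]), sum_const, nsmul_eq_mul, AddChar.mulShift_apply]
    rw [Int.cast_natCast] at hc'
    rw [hc']
    ring
  have h2 := gaussSum_mulShift χ (ZMod.stdAddChar (N := p)) (Units.mk0 _ ha)
  rw [Units.val_mk0] at h2
  have h3 : χ (a : ZMod p) = (jacobiSym a p : ℂ) := by
    rw [← jacobiSym.legendreSym.to_jacobiSym, hχ, MulChar.ringHomComp_apply]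
    rfl
  have h4 : ((jacobiSym a p : ℂ)) ^ 2 = 1 := by
    rw [← jacobiSym.legendreSym.to_jacobiSym]
    exact_mod_cast legendreSym.sq_one p ha
  rw [h1, ← h2, h3, ← mul_assoc, ← sq, h4, one_mul]

theorem gaussSign_two_mul_add_one (n : ℕ) :
    Complex.I ^ n * (-1) ^ (n / 2) = gaussSign (2 * n + 1) := by
  rcases Nat.even_or_odd' n with ⟨t, rfl | rfl⟩
  · rw [gaussSign, if_pos (by omega), pow_mul, Complex.I_sq, Nat.mul_div_cancel_left _ two_pos,
      ← mul_pow, neg_one_mul, neg_neg, one_pow]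
  · rw [gaussSign, if_neg (by omega), pow_succ, pow_mul, Complex.I_sq,
      show (2 * t + 1) / 2 = t by omega, mul_right_comm, ← mul_pow, neg_one_mul, neg_neg, one_pow,
      one_mul]

theorem norm_gaussSign (q : ℕ) : ‖gaussSign q‖ = 1 := by
  rw [gaussSign]; split_ifs <;> simp

/-- The quadratic Gauss sum of odd prime modulus, with its sign. -/
theorem quadGaussSum_prime {p : ℕ} [Fact p.Prime] (hp : p ≠ 2) {a : ℤ}
    (ha : (a : ZMod p) ≠ 0) :
    quadGaussSum p a = (jacobiSym a p : ℂ) * gaussSign p * (Real.sqrt p : ℝ) := by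
  have hpp : p.Prime := Fact.out
  have hF : ringChar (ZMod p) ≠ 2 := by rwa [ZMod.ringChar_zmod_n]
  rw [quadGaussSum_prime_eq_gaussSum hp ha, mul_assoc]
  congr 1
  have h1 := quadGaussSum_prime_eq_gaussSum hp (a := 1) (by simp)
  rw [jacobiSym.one_left, Int.cast_one, one_mul] at h1
  obtain ⟨n, hn⟩ := hpp.odd_of_ne_two hp
  obtain ⟨r, hr, hG⟩ := quadGaussSum_one_eq_sign_mul n
  rw [gaussSign_two_mul_add_one, ← hn] at hG
  set χ := (quadraticChar (ZMod p)).ringHomComp (Int.castRingHom ℂ) with hχ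
  have hinj : Function.Injective (Int.castRingHom ℂ) := Int.cast_injective
  have hsq := gaussSum_sq (χ := χ)
    (by rw [hχ, MulChar.ringHomComp_ne_one_iff hinj]; exact quadraticChar_ne_one hF)
    ((quadraticChar_isQuadratic (F := ZMod p)).comp _) (ZMod.isPrimitive_stdAddChar p)
  rw [← h1] at hsq ⊢
  -- The sign is already known, so the square of the Gauss sum is needed only in absolute value.
  have hnorm : r ^ 2 = p := by
    have := congrArg norm hsq
    rw [norm_pow, hG, norm_mul, norm_gaussSign, one_mul, norm_mul, ZMod.card, Complex.norm_natCast,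
      Complex.norm_real, Real.norm_of_nonneg hr.le] at this
    rw [this]
    have hu : ‖χ (-1)‖ = 1 := by
      have : χ (-1) ^ 2 = 1 := by rw [← map_pow]; simp
      have := congrArg norm this
      rw [norm_pow, norm_one] at this
      exact (pow_eq_one_iff_of_nonneg (norm_nonneg _) two_ne_zero).1 this
    rw [hu, one_mul]
  rw [hG, ← hnorm, Real.sqrt_sq hr.le]

/-- Put `v = x + p ^ (r + 1) * y`: the sum over `y` is linear and kills every `x` not divisible by
`p`; the survivors `x = p * z` form the sum modulo `p ^ r`. -/
theorem quadGaussSum_prime_pow_add_two {p : ℕ} [Fact p.Prime] (hp : p ≠ 2) (r : ℕ) {a : ℤ}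
    (ha : (a : ZMod p) ≠ 0) :
    quadGaussSum (p ^ (r + 2)) a = p * quadGaussSum (p ^ r) a := by
  have hpp : p.Prime := Fact.out
  have h1 (x y : ℕ) : expMod (p ^ (r + 2)) (a * ((x + p ^ (r + 1) * y : ℕ) : ℤ) ^ 2) =
      expMod (p ^ (r + 2)) (a * (x : ℤ) ^ 2) * expMod p ((2 * a * x) * y) := by
    have e := expMod_mul_mul (N := p) (M := p ^ (r + 1)) (pow_ne_zero _ hpp.ne_zero)
      ((2 * a * x) * y)
    rw [← pow_succ'] at e
    rw [← e, ← expMod_add]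
    apply expMod_congr
    push_cast
    refine ⟨-(a * p ^ r * y ^ 2), ?_⟩
    ring
  have h2 (x : ℕ) : ((p : ℤ) ∣ 2 * a * x) ↔ (p ∣ x) := by
    rw [← ZMod.intCast_zmod_eq_zero_iff_dvd]
    push_cast
    have h20 : (2 : ZMod p) ≠ 0 := by
      have : ((2 : ℕ) : ZMod p) ≠ 0 := by
        rw [Ne, ZMod.natCast_eq_zero_iff, Nat.prime_dvd_prime_iff_eq hpp Nat.prime_two]
        exact hp
      exact_mod_cast this
    rw [mul_eq_zero, or_iff_right (mul_ne_zero h20 ha), ZMod.natCast_eq_zero_iff]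
  rw [quadGaussSum, pow_succ p (r + 1), sum_range_mul_eq, ← pow_succ]
  simp only [h1, ← mul_sum, sum_range_expMod_mul, h2]
  rw [pow_succ' p r, sum_range_mul_eq, sum_comm, quadGaussSum, mul_sum]
  refine sum_congr rfl fun z _ => ?_
  rw [sum_eq_single_of_mem 0 (mem_range.2 hpp.pos)]
  · rw [zero_add, if_pos (dvd_mul_right _ _), mul_comm]
    have e := expMod_mul_mul (N := p ^ r) (M := p ^ 2) (pow_ne_zero _ hpp.ne_zero)
      (a * (z : ℤ) ^ 2)
    rw [← e, ← pow_add]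
    push_cast
    congr 2
    ring
  · intro x hx hx0
    rw [if_neg, mul_zero]
    rw [← Nat.dvd_add_iff_left (dvd_mul_right p z)]
    exact fun h => hx0 (Nat.eq_zero_of_dvd_of_lt h (mem_range.1 hx))

theorem gaussSign_pow_add_two {p : ℕ} (hp : Odd p) (r : ℕ) :
    gaussSign (p ^ (r + 2)) = gaussSign (p ^ r) := by
  have h : p ^ 2 % 4 = 1 := by
    obtain ⟨n, rfl⟩ := hp
    rw [show (2 * n + 1) ^ 2 = 4 * (n * n + n) + 1 by ring]; omega
  rw [gaussSign, gaussSign, pow_add, Nat.mul_mod, h, mul_one, Nat.mod_mod]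

/-- The quadratic Gauss sum of odd prime power modulus. -/
theorem quadGaussSum_prime_pow {p : ℕ} [Fact p.Prime] (hp : p ≠ 2) (r : ℕ) {a : ℤ}
    (ha : (a : ZMod p) ≠ 0) :
    quadGaussSum (p ^ r) a =
      (jacobiSym a (p ^ r) : ℂ) * gaussSign (p ^ r) * (Real.sqrt ((p : ℝ) ^ r) : ℝ) := by
  have hpp : p.Prime := Fact.out
  induction r using Nat.twoStepInduction with
  | zero => simp [quadGaussSum, expMod_zero, gaussSign]
  | one => simpa using quadGaussSum_prime hp ha
  | more r ih _ =>
    have h4 : ((jacobiSym a p : ℂ)) ^ 2 = 1 := by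
      rw [← jacobiSym.legendreSym.to_jacobiSym]
      exact_mod_cast legendreSym.sq_one p ha
    rw [quadGaussSum_prime_pow_add_two hp r ha, ih, gaussSign_pow_add_two (hpp.odd_of_ne_two hp),
      jacobiSym.pow_right, jacobiSym.pow_right, pow_add (p : ℝ), Real.sqrt_mul (by positivity),
      Real.sqrt_sq (by positivity)]
    push_cast
    rw [pow_add, h4]
    ring

/-! ### Quadratic phases and averaging over the coset -/

/-- For `u = v + N * w` the quadratic term depends only on `v` modulo `N * J ^ 2`, and the linear
term gives a character sum modulo `J` in `w`, which detects `J ∣ A`. -/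
theorem sum_expMod_quadratic (N J : ℕ) [NeZero N] [NeZero J] (A B : ℤ) :
    ∑ u ∈ range (N * J), expMod (N * J ^ 2) (J * A * u - J ^ 2 * B * u ^ 2) =
      if (J : ℤ) ∣ A then
        (J : ℂ) * ∑ v ∈ range N, expMod N (A / J * v - B * v ^ 2) else 0 := by
  have hN : N ≠ 0 := NeZero.ne N
  have hJ : J ≠ 0 := NeZero.ne J
  have : NeZero (N * J ^ 2) := ⟨mul_ne_zero hN (pow_ne_zero 2 hJ)⟩
  have h1 (v w : ℕ) : expMod (N * J ^ 2)
      (J * A * ((v + N * w : ℕ) : ℤ) - J ^ 2 * B * ((v + N * w : ℕ) : ℤ) ^ 2) =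
      expMod (N * J ^ 2) (J * A * v - J ^ 2 * B * v ^ 2) * expMod J (A * w) := by
    have e := expMod_mul_mul (N := J) (M := N * J) (mul_ne_zero hN hJ) (A * w)
    rw [show J * (N * J) = N * J ^ 2 by ring] at e
    rw [← e, ← expMod_add]
    apply expMod_congr
    push_cast
    refine ⟨B * (2 * v * w + N * w ^ 2), ?_⟩
    ring
  rw [sum_range_mul_eq]
  simp only [h1, ← mul_sum, sum_range_expMod_mul]
  split_ifs with h
  · obtain ⟨D, rfl⟩ := h
    rw [← sum_mul, mul_comm, Int.mul_ediv_cancel_left _ (by exact_mod_cast hJ)]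
    congr 1
    refine sum_congr rfl fun v _ => ?_
    rw [← expMod_mul_mul (N := N) (M := J ^ 2) (pow_ne_zero 2 hJ)]
    congr 1
    push_cast
    ring
  · simp

theorem sum_expMod_complete_square (N : ℕ) [NeZero N] {A B c : ℤ} (h : (N : ℤ) ∣ 2 * B * c - A) :
    ∑ v ∈ range N, expMod N (A * v - B * v ^ 2) =
      expMod N (B * c ^ 2) * quadGaussSum N (-B) := by
  obtain ⟨d, hd⟩ := h
  have hs := sum_range_shift N (fun z => ZMod.stdAddChar (((-B : ℤ) : ZMod N) * z ^ 2))
    ((-c : ℤ) : ZMod N)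
  rw [quadGaussSum_eq_sum_zmod, ← sum_range_eq_sum_zmod, ← hs, mul_sum]
  refine sum_congr rfl fun v _ => ?_
  have e := stdAddChar_intCast N (-B * ((v : ℤ) + -c) ^ 2)
  push_cast at e ⊢
  rw [e, ← expMod_add]
  apply expMod_congr
  exact ⟨d * v, by linear_combination (v : ℤ) * hd⟩

theorem sum_zmod_of_castHom_eq_one {p k j : ℕ} [Fact p.Prime] (hjk : j ≤ k)
    (g : ZMod (p ^ k) → ℂ) :
    ∑ t, g t * (if ZMod.castHom (pow_dvd_pow p hjk) (ZMod (p ^ j)) t = 1 then 1 else 0) =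
      ∑ u ∈ range (p ^ (k - j)), g ((1 + (p : ℤ) ^ j * u : ℤ) : ZMod (p ^ k)) := by
  have hpp : p.Prime := Fact.out
  rw [← sum_range_eq_sum_zmod, ← sum_range_shift (p ^ k) (fun t => g t *
    (if ZMod.castHom (pow_dvd_pow p hjk) (ZMod (p ^ j)) t = 1 then 1 else 0)) 1]
  have hk : p ^ k = p ^ j * p ^ (k - j) := by rw [← pow_add, Nat.add_sub_cancel' hjk]
  conv_lhs => rw [show range (p ^ k) = range (p ^ j * p ^ (k - j)) by rw [← hk]]
  rw [sum_range_mul_eq, sum_eq_single_of_mem 0 (mem_range.2 (pow_pos hpp.pos j))]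
  · refine sum_congr rfl fun y _ => ?_
    rw [if_pos]
    · rw [mul_one]
      congr 1
      push_cast
      ring
    · rw [map_add, map_one, map_natCast, zero_add, Nat.cast_mul, ZMod.natCast_self, zero_mul,
        zero_add]
  · intro x hx hx0
    refine sum_eq_zero fun y _ => ?_
    rw [if_neg, mul_zero]
    rw [map_add, map_one, map_natCast, add_eq_right, Nat.cast_add, Nat.cast_mul,
      ZMod.natCast_self, zero_mul, add_zero, ZMod.natCast_eq_zero_iff]
    exact fun h => hx0 (Nat.eq_zero_of_dvd_of_lt h (mem_range.1 hx))

theorem DirichletCharacter.conj_mul_self_of_isUnit {n : ℕ} (χ : DirichletCharacter ℂ n)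
    {a : ZMod n} (ha : IsUnit a) : χ a * (starRingEnd ℂ) (χ a) = 1 := by
  have : ‖χ a‖ = 1 := by
    obtain ⟨u, rfl⟩ := ha
    exact χ.unit_norm_eq_one u
  rw [Complex.mul_conj, Complex.normSq_eq_norm_sq, this]
  simp

open scoped Classical in
/-- Orthogonality of the even Dirichlet characters modulo `n`. -/
theorem DirichletCharacter.sum_even_mul_conj {n : ℕ} [NeZero n] {a : ZMod n} (ha : IsUnit a)
    (b : ZMod n) :
    ∑ ψ : {ψ : DirichletCharacter ℂ n // ψ.Even}, ψ.1 b * (starRingEnd ℂ) (ψ.1 a) =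
      (n.totient : ℂ) / 2 *
        ∑ s ∈ ({1, -1} : Finset ℤ), if b = (s : ZMod n) * a then 1 else 0 := by
  have hconj (ψ : DirichletCharacter ℂ n) : (starRingEnd ℂ) (ψ a) = ψ a⁻¹ := by
    have h1 := ψ.conj_mul_self_of_isUnit ha
    have h2 : ψ a * ψ a⁻¹ = 1 := by rw [← map_mul, ZMod.mul_inv_of_unit a ha, map_one]
    exact mul_left_cancel₀ (left_ne_zero_of_mul_eq_one h1) (h1.trans h2.symm)
  have h1 : ∑ ψ : {ψ : DirichletCharacter ℂ n // ψ.Even}, ψ.1 b * (starRingEnd ℂ) (ψ.1 a) =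
      -- The weight `(1 + ψ (-1)) / 2` projects to even characters, and `ψ (-1) * ψ b = ψ (-b)`
      -- yields the second sign.
      ∑ ψ : DirichletCharacter ℂ n, (1 + ψ (-1)) / 2 * (ψ b * (starRingEnd ℂ) (ψ a)) := by
    rw [← sum_subtype (univ.filter fun ψ : DirichletCharacter ℂ n => ψ.Even) (by simp)
      fun ψ => ψ b * (starRingEnd ℂ) (ψ a), sum_filter]
    refine sum_congr rfl fun ψ _ => ?_
    split_ifs with he
    · rw [he]; norm_num
    · rw [(ψ.even_or_odd.resolve_left he : ψ (-1) = -1)]; norm_num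
  rw [h1, sum_pair (by norm_num)]
  have o1 := DirichletCharacter.sum_char_inv_mul_char_eq ℂ ha b
  have o2 := DirichletCharacter.sum_char_inv_mul_char_eq ℂ ha (-b)
  have h2 : ∑ ψ : DirichletCharacter ℂ n, (1 + ψ (-1)) / 2 * (ψ b * (starRingEnd ℂ) (ψ a)) =
      (∑ ψ : DirichletCharacter ℂ n, ψ a⁻¹ * ψ b + ∑ ψ : DirichletCharacter ℂ n, ψ a⁻¹ * ψ (-b)) /
        2 := by
    rw [← sum_add_distrib, sum_div]
    refine sum_congr rfl fun ψ _ => ?_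
    rw [hconj, neg_eq_neg_one_mul b, map_mul ψ (-1) b]
    ring
  rw [h2, o1, o2]
  simp only [Int.cast_one, one_mul, Int.cast_neg, neg_mul, eq_comm (a := b), neg_eq_iff_eq_neg]
  split_ifs <;> ring

theorem DirichletCharacter.mul_changeLevel_apply {n d : ℕ} (h : d ∣ n)
    (χ : DirichletCharacter ℂ n) (ψ : DirichletCharacter ℂ d) (t : ZMod n) :
    (χ * DirichletCharacter.changeLevel h ψ) t = χ t * ψ (ZMod.castHom h (ZMod d) t) := by
  rw [MulChar.mul_apply]
  by_cases ht : IsUnit t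
  · obtain ⟨u, rfl⟩ := ht
    rw [DirichletCharacter.changeLevel_eq_cast_of_dvd, ZMod.castHom_apply]
  · rw [χ.map_nonunit ht, zero_mul, zero_mul]

theorem DirichletCharacter.mul_changeLevel_even {n d : ℕ} (h : d ∣ n)
    {χ : DirichletCharacter ℂ n} {ψ : DirichletCharacter ℂ d} (hχ : χ.Even) (hψ : ψ.Even) :
    (χ * DirichletCharacter.changeLevel h ψ).Even := by
  rw [DirichletCharacter.Even, DirichletCharacter.mul_changeLevel_apply,
    map_neg (ZMod.castHom h _), map_one, hχ, hψ, one_mul]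

theorem sum_evenCoset {p k j : ℕ} [Fact p.Prime] (hjk : j ≤ k)
    (χ : DirichletCharacter ℂ (p ^ k)) (hχ : χ.Even) {m : ℤ} (hm : IsCoprime m (p : ℤ)) :
    ∑ η ∈ evenCoset hjk χ, η.rootNumber * (starRingEnd ℂ) (η (m : ZMod (p ^ k))) =
      ((p ^ j).totient : ℂ) / 2 / ((p ^ k : ℕ) : ℂ) ^ (1 / 2 : ℂ) *
        ∑ s ∈ ({1, -1} : Finset ℤ), ∑ u ∈ range (p ^ (k - j)),
          χ ((1 + (p : ℤ) ^ j * u : ℤ) : ZMod (p ^ k)) *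
            expMod (p ^ k) (s * m * (1 + (p : ℤ) ^ j * u)) := by
  classical
  have hd := pow_dvd_pow p hjk
  have hmk (i : ℕ) : IsUnit (m : ZMod (p ^ i)) := by
    rw [ZMod.coe_int_isUnit_iff_isCoprime, Nat.cast_pow]
    exact hm.symm.pow_left
  have hinj : Function.Injective fun ψ : {ψ : DirichletCharacter ℂ (p ^ j) // ψ.Even} =>
      χ * DirichletCharacter.changeLevel hd ψ.1 := fun a b h =>
    Subtype.ext (DirichletCharacter.changeLevel_injective hd (mul_left_cancel h))
  have h1 : ∑ η ∈ evenCoset hjk χ, η.rootNumber * (starRingEnd ℂ) (η (m : ZMod (p ^ k))) =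
      ∑ ψ : {ψ : DirichletCharacter ℂ (p ^ j) // ψ.Even},
        (χ * DirichletCharacter.changeLevel hd ψ.1).rootNumber *
        (starRingEnd ℂ) ((χ * DirichletCharacter.changeLevel hd ψ.1) (m : ZMod (p ^ k))) := by
    rw [evenCoset, sum_image fun a _ b _ h => hinj h]
  have h2 (ψ : {ψ : DirichletCharacter ℂ (p ^ j) // ψ.Even}) :
      (χ * DirichletCharacter.changeLevel hd ψ.1).rootNumber *
        (starRingEnd ℂ) ((χ * DirichletCharacter.changeLevel hd ψ.1) (m : ZMod (p ^ k))) =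
      ∑ t : ZMod (p ^ k), χ t * ZMod.stdAddChar t * (starRingEnd ℂ) (χ (m : ZMod (p ^ k))) /
        ((p ^ k : ℕ) : ℂ) ^ (1 / 2 : ℂ) *
        (ψ.1 (ZMod.castHom hd _ t) * (starRingEnd ℂ) (ψ.1 (m : ZMod (p ^ j)))) := by
    rw [DirichletCharacter.rootNumber, if_pos (DirichletCharacter.mul_changeLevel_even hd hχ ψ.2),
      pow_zero, div_one, gaussSum, DirichletCharacter.mul_changeLevel_apply,
      map_intCast (ZMod.castHom hd (ZMod (p ^ j))), map_mul, sum_div, sum_mul]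
    refine sum_congr rfl fun t _ => ?_
    rw [DirichletCharacter.mul_changeLevel_apply]
    ring
  rw [h1, sum_congr rfl fun ψ _ => h2 ψ, sum_comm]
  simp only [← mul_sum, DirichletCharacter.sum_even_mul_conj (hmk j)]
  have h3 (s : ℤ) (hs : s ∈ ({1, -1} : Finset ℤ)) :
      ∑ t : ZMod (p ^ k), χ t * ZMod.stdAddChar t * (starRingEnd ℂ) (χ (m : ZMod (p ^ k))) *
        (if ZMod.castHom hd (ZMod (p ^ j)) t = (s : ZMod (p ^ j)) * m then 1 else 0) =
      ∑ u ∈ range (p ^ (k - j)), χ ((1 + (p : ℤ) ^ j * u : ℤ) : ZMod (p ^ k)) *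
            expMod (p ^ k) (s * m * (1 + (p : ℤ) ^ j * u)) := by
    have hs' : s = 1 ∨ s = -1 := by simpa using hs
    have hsu (i : ℕ) : IsUnit ((s : ZMod (p ^ i)) * m) := by
      refine IsUnit.mul ?_ (hmk i)
      rcases hs' with rfl | rfl <;> simp
    have hχs : χ (s : ZMod (p ^ k)) = 1 := by
      rcases hs' with rfl | rfl
      · simp
      · push_cast; exact hχ
    have hg := sum_zmod_of_castHom_eq_one hjk
      (fun t => χ t * ZMod.stdAddChar ((s : ZMod (p ^ k)) * (m : ZMod (p ^ k)) * t))
    -- Substituting `s * m * t` for `t` moves the residue class to `t ≡ 1`; the values of `χ` at `s`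
    -- and `m` cancel, by evenness and against the conjugate.
    rw [← Equiv.sum_comp (Units.mulLeft (hsu k).unit)]
    calc _ = _ := by
          refine sum_congr rfl fun t _ => ?_
          rw [Units.mulLeft_apply, IsUnit.unit_spec, map_mul (ZMod.castHom hd _),
            map_mul (ZMod.castHom hd _), map_intCast (ZMod.castHom hd (ZMod (p ^ j))),
            map_intCast (ZMod.castHom hd (ZMod (p ^ j))), map_mul χ, map_mul χ, hχs]
          simp only [(hsu j).mul_eq_left]
          linear_combination
            (χ t * ZMod.stdAddChar ((s : ZMod (p ^ k)) * (m : ZMod (p ^ k)) * t) *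
              (if ZMod.castHom hd (ZMod (p ^ j)) t = 1 then 1 else 0)) *
                χ.conj_mul_self_of_isUnit (hmk k)
      _ = _ := hg
      _ = _ := by
          refine sum_congr rfl fun u _ => ?_
          rw [← stdAddChar_intCast]
          push_cast
          rfl
  rw [← sum_congr rfl h3, sum_comm, mul_sum]
  refine sum_congr rfl fun t _ => ?_
  rw [mul_sum, mul_sum, mul_sum]
  refine sum_congr rfl fun s _ => ?_
  ring

/-- On `1 + p ^ j ℤ` with `3 * j ≥ k`, a character modulo `p ^ k` is given by a quadratic phase. -/
theorem IsLogParam.apply_one_add {p k j : ℕ} [Fact p.Prime] (hp : 5 ≤ p) (hk : 1 ≤ k)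
    (hj : 1 ≤ j) (hkj : k ≤ 3 * j) {χ : DirichletCharacter ℂ (p ^ k)} {ℓ B : ℤ}
    (hℓ : IsLogParam χ (ℓ : ZMod (p ^ (k - 1)))) {h : ℤ} (hh : 2 * h = (p : ℤ) ^ k + 1)
    (hB : B = h * ℓ) (u : ℤ) :
    χ ((1 + (p : ℤ) ^ j * u : ℤ) : ZMod (p ^ k)) =
      expMod (p ^ k) (ℓ * ((p : ℤ) ^ j * u) - B * ((p : ℤ) ^ j * u) ^ 2) := by
  have h1 := (isLogParam_intCast_iff hp hk χ ℓ).1 hℓ ((p : ℤ) ^ (j - 1) * u)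
  rw [← mul_assoc, ← pow_succ', Nat.sub_add_cancel hj] at h1
  rw [h1, ← stdAddChar_intCast]
  congr 1
  have h2 := two_mul_toZModPow_padicIntLog hp hj hkj u
  have h3 : ((h : ZMod (p ^ k))) * 2 = 1 := by
    have : ((2 * h : ℤ) : ZMod (p ^ k)) = 1 := by
      rw [hh]; push_cast
      have := ZMod.natCast_self (p ^ k)
      push_cast at this
      rw [this, zero_add]
    push_cast at this
    rw [mul_comm, this]
  subst hB
  push_cast at h2 ⊢
  linear_combination (ℓ : ZMod (p ^ k)) * h * h2 - ((ℓ : ZMod (p ^ k)) *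
    PadicInt.toZModPow k (padicIntLog p ((p : ℤ) ^ (j - 1) * u)) -
      ℓ * (p ^ j * u)) * h3

theorem natCast_prime_pow_cpow_half {p k j : ℕ} (hjk : 2 * j ≤ k) :
    ((p ^ k : ℕ) : ℂ) ^ (1 / 2 : ℂ) = (p : ℂ) ^ j * (Real.sqrt ((p : ℝ) ^ (k - 2 * j)) : ℝ) := by
  have h : ((p ^ k : ℕ) : ℝ) = ((p : ℝ) ^ j) ^ 2 * (p : ℝ) ^ (k - 2 * j) := by
    rw [← pow_mul, ← pow_add, mul_comm j, Nat.add_sub_cancel' hjk, Nat.cast_pow]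
  have h2 : ((p ^ k : ℕ) : ℂ) ^ (1 / 2 : ℂ) = ((Real.sqrt ((p ^ k : ℕ) : ℝ) : ℝ) : ℂ) := by
    rw [Real.sqrt_eq_rpow, Complex.ofReal_cpow (by positivity)]
    norm_num
  rw [h2, h, Real.sqrt_mul (by positivity), Real.sqrt_sq (by positivity)]
  push_cast
  rfl

theorem gaussSign_pow_add_two_mul {p : ℕ} (hp : Odd p) (r j : ℕ) :
    gaussSign (p ^ (r + 2 * j)) = gaussSign (p ^ r) := by
  induction j with
  | zero => rfl
  | succ j ih => rw [Nat.mul_succ, ← add_assoc, gaussSign_pow_add_two hp, ih]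

/-- Modulo `p`, `-2 * ℓ` is `4 * (-B)`, so the symbols agree; and `k - 2 * j` has the parity of `k`,
so symbol and sign may be taken modulo `p ^ k`. -/
theorem quadGaussSum_neg_half {p k j : ℕ} [Fact p.Prime] (hp : p ≠ 2) (hjk : 2 * j ≤ k)
    {ℓ B : ℤ} (hℓ : (ℓ : ZMod p) ≠ 0) (hk : 1 ≤ k) (hB : 2 * B = ℓ * ((p : ℤ) ^ k + 1)) :
    quadGaussSum (p ^ (k - 2 * j)) (-B) =
      (jacobiSym (-2 * ℓ) (p ^ k) : ℂ) * gaussSign (p ^ k) *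
        (Real.sqrt ((p : ℝ) ^ (k - 2 * j)) : ℝ) := by
  have hpp : p.Prime := Fact.out
  have h2B : (2 : ZMod p) * B = ℓ := by
    have := congrArg (Int.cast : ℤ → ZMod p) hB
    push_cast at this
    rw [this, CharP.cast_eq_zero, zero_pow (by omega), zero_add, mul_one]
  have hB0 : ((-B : ℤ) : ZMod p) ≠ 0 := by
    intro h
    rw [Int.cast_neg, neg_eq_zero] at h
    exact hℓ (by rw [← h2B, h, mul_zero])
  have h20 : ((2 : ℤ) : ZMod p) ≠ 0 := by
    intro h
    push_cast at h
    exact hℓ (by rw [← h2B, h, zero_mul])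
  have hsq (a : ℤ) (ha : (a : ZMod p) ≠ 0) : jacobiSym a p ^ 2 = 1 := by
    rw [← jacobiSym.legendreSym.to_jacobiSym]
    exact legendreSym.sq_one p ha
  obtain ⟨r, rfl⟩ : ∃ r, k = r + 2 * j := ⟨k - 2 * j, by omega⟩
  have hJ : jacobiSym (-2 * ℓ) p = jacobiSym (-B) p := by
    have : jacobiSym (-2 * ℓ) p = jacobiSym (2 ^ 2 * -B) p := by
      rw [← jacobiSym.legendreSym.to_jacobiSym, ← jacobiSym.legendreSym.to_jacobiSym, legendreSym,
        legendreSym]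
      congr 1
      push_cast
      rw [← h2B]
      ring
    rw [this, jacobiSym.mul_left, jacobiSym.pow_left, hsq 2 h20, one_mul]
  rw [Nat.add_sub_cancel, quadGaussSum_prime_pow hp r hB0,
    gaussSign_pow_add_two_mul (hpp.odd_of_ne_two hp)]
  congr 3
  rw [jacobiSym.pow_right, jacobiSym.pow_right, hJ, pow_add, pow_mul, hsq _ hB0, one_pow, mul_one]

/-- The complete exponential sum attached to a residue class modulo `p ^ j`. -/
theorem IsLogParam.sum_apply_one_add {p k j : ℕ} [Fact p.Prime] (hp : 5 ≤ p) (hj : 1 ≤ j)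
    (hkj : k ≤ 3 * j) (hjk : 2 * j ≤ k) {χ : DirichletCharacter ℂ (p ^ k)} {ℓ n : ℤ}
    (hℓ : IsLogParam χ (ℓ : ZMod (p ^ (k - 1)))) (hn : IsCoprime n (p : ℤ)) :
    ∑ u ∈ range (p ^ (k - j)), χ ((1 + (p : ℤ) ^ j * u : ℤ) : ZMod (p ^ k)) *
        expMod (p ^ k) (n * (1 + (p : ℤ) ^ j * u)) =
      ((p ^ k : ℕ) : ℂ) ^ (1 / 2 : ℂ) * (ZMod.stdAddChar ((n : ℤ) : ZMod (p ^ k)) *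
        (if ℓ ≡ -n [ZMOD ((p ^ j : ℕ) : ℤ)] then (1 : ℂ) else 0) *
        (jacobiSym (-2 * ℓ) (p ^ k) : ℂ) * gaussSign (p ^ k) *
        ZMod.stdAddChar (((2 * ℓ : ℤ) : ZMod (p ^ (k - 2 * j)))⁻¹ *
          (((ℓ + n) / ((p ^ j : ℕ) : ℤ) : ℤ) : ZMod (p ^ (k - 2 * j))) ^ 2)) := by
  have hpp : p.Prime := Fact.out
  have hp2 : p ≠ 2 := by omega
  have hk1 : 1 ≤ k := by omega
  -- The integer `h` represents one half modulo `p ^ k`, so `B` below represents `ℓ / 2`.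
  obtain ⟨h, hh⟩ : ∃ h : ℤ, 2 * h = (p : ℤ) ^ k + 1 := by
    obtain ⟨t, ht⟩ := (hpp.odd_of_ne_two hp2).pow (n := k)
    exact ⟨t + 1, by exact_mod_cast (show 2 * (t + 1) = p ^ k + 1 by omega)⟩
  set B := h * ℓ with hB
  have hNJ : p ^ (k - 2 * j) * (p ^ j) ^ 2 = p ^ k := by
    rw [← pow_mul, ← pow_add]; congr 1; omega
  have hNJ' : p ^ (k - 2 * j) * p ^ j = p ^ (k - j) := by
    rw [← pow_add]; congr 1; omega
  have hterm (u : ℕ) : χ ((1 + (p : ℤ) ^ j * u : ℤ) : ZMod (p ^ k)) *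
      expMod (p ^ k) (n * (1 + (p : ℤ) ^ j * u)) = expMod (p ^ k) n *
        expMod (p ^ k) (((p ^ j : ℕ) : ℤ) * (ℓ + n) * u - ((p ^ j : ℕ) : ℤ) ^ 2 * B * u ^ 2) := by
    rw [hℓ.apply_one_add hp hk1 hj hkj hh hB, ← expMod_add, ← expMod_add]
    congr 1
    push_cast
    ring
  have hs := sum_expMod_quadratic (p ^ (k - 2 * j)) (p ^ j) (ℓ + n) B
  rw [hNJ, hNJ'] at hs
  have hiff : ℓ ≡ -n [ZMOD ((p ^ j : ℕ) : ℤ)] ↔ ((p ^ j : ℕ) : ℤ) ∣ ℓ + n := by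
    rw [Int.modEq_comm, Int.modEq_iff_dvd, sub_neg_eq_add]
  rw [sum_congr rfl fun u _ => hterm u, ← mul_sum, hs, stdAddChar_intCast]
  simp only [hiff]
  split_ifs with hd
  swap
  · ring
  have hpd : (p : ℤ) ∣ ℓ + n := (by exact_mod_cast dvd_pow_self (p : ℤ) (by omega : j ≠ 0) :
    (p : ℤ) ∣ ((p ^ j : ℕ) : ℤ)).trans hd
  -- On the surviving branch `ℓ ≡ -n` modulo `p`, so `ℓ` inherits coprimality from `n`.
  have hcop : IsCoprime ℓ (p : ℤ) := by
    obtain ⟨c, hc⟩ := hpd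
    rw [show ℓ = -n + p * c by linear_combination hc]
    exact IsCoprime.add_mul_left_left hn.neg_left c
  have hℓ0 : (ℓ : ZMod p) ≠ 0 := by
    have := (ZMod.coe_int_isUnit_iff_isCoprime ℓ p).2 hcop.symm
    exact this.ne_zero
  set A := (ℓ + n) / ((p ^ j : ℕ) : ℤ) with hA
  set N := p ^ (k - 2 * j) with hN
  have h2cop : IsCoprime (2 : ℤ) (p : ℤ) := by
    have := (Nat.coprime_primes Nat.prime_two hpp).2 (Ne.symm hp2)
    exact_mod_cast Nat.isCoprime_iff_coprime.2 this
  have hu : IsUnit (ℓ : ZMod N) := by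
    rw [ZMod.coe_int_isUnit_iff_isCoprime, hN, Nat.cast_pow]
    exact hcop.symm.pow_left
  have hu2 : IsUnit ((2 * ℓ : ℤ) : ZMod N) := by
    rw [ZMod.coe_int_isUnit_iff_isCoprime, hN, Nat.cast_pow]
    exact (h2cop.mul_left hcop).symm.pow_left
  have h2B : 2 * B = ℓ * ((p : ℤ) ^ k + 1) := by rw [hB, ← hh]; ring
  have h2BN : (2 : ZMod N) * B = ℓ := by
    have e := congrArg (Int.cast : ℤ → ZMod N) h2B
    have e0 : (p : ZMod N) ^ k = 0 := by
      have := (ZMod.natCast_eq_zero_iff (p ^ k) N).2 (pow_dvd_pow p (Nat.sub_le _ _))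
      exact_mod_cast this
    push_cast at e
    rw [e, e0, zero_add, mul_one]
  -- The centre of the square is `A / (2 * B) = A / ℓ`, and the phase left over is `B * c ^ 2 = A ^
  -- 2 / (2 * ℓ)`.
  set c : ℤ := (((A : ZMod N) * (ℓ : ZMod N)⁻¹).val : ℤ) with hc
  have hcA : (ℓ : ZMod N) * c = A := by
    rw [hc, Int.cast_natCast, ZMod.natCast_val, ZMod.cast_id', id]
    linear_combination (A : ZMod N) * ZMod.mul_inv_of_unit _ hu
  have hsquare := sum_expMod_complete_square N (A := A) (B := B) (c := c) (by
    rw [← ZMod.intCast_zmod_eq_zero_iff_dvd]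
    push_cast
    rw [h2BN, hcA, sub_self])
  have hphase : expMod N (B * c ^ 2) =
      ZMod.stdAddChar (((2 * ℓ : ℤ) : ZMod N)⁻¹ * (A : ZMod N) ^ 2) := by
    rw [← stdAddChar_intCast]
    congr 1
    apply hu2.mul_left_cancel
    rw [← mul_assoc, ZMod.mul_inv_of_unit _ hu2]
    push_cast
    linear_combination ((ℓ : ZMod N) * c ^ 2) * h2BN + ((ℓ : ZMod N) * c + A) * hcA
  rw [hsquare, hphase, quadGaussSum_neg_half hp2 hjk hℓ0 hk1 h2B, natCast_prime_pow_cpow_half hjk]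
  push_cast
  ring

end ExponentialSums

/-! ### The main theorem -/

theorem mainTheorem4 (p k j : ℕ) [Fact p.Prime] (hp : 5 ≤ p) (hk : 2 ≤ k)
    (hkj : k ≤ 3 * j) (hjk : 2 * j ≤ k)
    (χ : DirichletCharacter ℂ (p ^ k)) (hχ : χ.IsPrimitive) (hχeven : χ.Even)
    (m : ℤ) (hm : IsCoprime m (p : ℤ)) :
    (∃! a : ZMod (p ^ (k - 1)), IsLogParam χ a) ∧
    ∀ ℓ : ℤ, IsLogParam χ (ℓ : ZMod (p ^ (k - 1))) →
      ∑ η ∈ evenCoset (show j ≤ k by omega) χ,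
          η.rootNumber * (starRingEnd ℂ) (η (m : ZMod (p ^ k))) =
        ((p ^ j).totient : ℂ) * ∑ s ∈ ({1, -1} : Finset ℤ),
          (1 / 2 : ℂ) * ZMod.stdAddChar ((s * m : ℤ) : ZMod (p ^ k)) *
            (if ℓ ≡ -(s * m) [ZMOD ((p ^ j : ℕ) : ℤ)] then (1 : ℂ) else 0) *
            (jacobiSym (-2 * ℓ) (p ^ k) : ℂ) * gaussSign (p ^ k) *
            ZMod.stdAddChar (((2 * ℓ : ℤ) : ZMod (p ^ (k - 2 * j)))⁻¹ *
              (((ℓ + s * m) / ((p ^ j : ℕ) : ℤ) : ℤ) : ZMod (p ^ (k - 2 * j))) ^ 2) := by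
  have hpp : p.Prime := Fact.out
  refine ⟨existsUnique_isLogParam hp (by omega) χ, fun ℓ hℓ => ?_⟩
  have hq : ((p ^ k : ℕ) : ℂ) ^ (1 / 2 : ℂ) ≠ 0 := by
    rw [Ne, Complex.cpow_eq_zero_iff, not_and_or]
    exact Or.inl (by exact_mod_cast pow_ne_zero k hpp.ne_zero)
  rw [sum_evenCoset _ χ hχeven hm, Finset.mul_sum, Finset.mul_sum]
  refine Finset.sum_congr rfl fun s hs => ?_
  have hs' : s = 1 ∨ s = -1 := by simpa using hs
  have hsm : IsCoprime (s * m) (p : ℤ) := by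
    rcases hs' with rfl | rfl
    · rwa [one_mul]
    · rw [neg_one_mul]; exact hm.neg_left
  -- Each sign is the case `n = s * m`; `j ≥ 1` follows from `2 ≤ k ≤ 3 * j`.
  rw [hℓ.sum_apply_one_add hp (by omega) hkj hjk hsm]
  field_simp
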